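/- **Privacy and running time of the Subtree Smoothing scheme.** *Setting.* A histogram algorithm $F$ maps a dataset (a finite multiset of records) to a vector $h=F(D)\in\mathbb N^n$, $n\ge 1$, such that adding one record either leaves the histogram unchanged or increments a single bin by $1$. A mechanism $M$ is $\varepsilon$-differentially private for $F$ if $\Pr[M(F(D))\in S]\le e^{\varepsilon}\Pr[M(F(D'))\in S]$ for all measurable $S$ and all $D,D'$ such that one arises from the other by removing a record. $\mathrm{Lap}(b)$ is the zero-mean Laplace distribution with scale $b$. *The tree.* Let $f\ge 2$ be the fan-out and $t=\lceil\log_f n\rceil+1$ the number of levels of the aggregate tree of $h$: level $k\in\{0,\dots,t-1\}$ ($0$ = leaves) has $\lceil n/f^k\rceil$ nodes, and its $j$-th node $(j\ge0)$ holds the sum of the bins $i\in\{0,\dots,n-1\}$ with $\lfloor i/f^k\rfloor=j$. A subtree rooted in level $k$ is full if it has $f^k$ leaves. *The scheme.* Let $\varepsilon>0$, and let $\alpha_\ell>0$ for the $t$ levels $\ell$, with $\sum_\ell\alpha_\ell=t$. 1. *Smoothing module* (budget $\varepsilon/4$). It outputs a permissible grouping strategy, i.e. a partition of the bins all of whose groups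 are leaf sets of full subtrees. For the squared error metric, independent $\mathrm{Lap}(4/\varepsilon)$ noise is added to every bin, and the output is a permissible strategy $G$ minimizing $\sum_{g\in G}\bigl(\sum_{i\in g}(\hat b_i-\bar g)^2+v^2\bigr)$, where $\hat b_i$ are the noisy bins, $\bar g$ is their average over $g$, and $v=4t/(3\varepsilon)$; optionally, the cost of each group is first reduced by $2(|g|-1)/(\varepsilon/4)^2$. Ties are broken by any measurable rule. 2. *Hierarchy Level modules.* A node strictly below the root of a full subtree whose leaf set is a group (a group root) is pruned. For each level $\ell$, independent $\mathrm{Lap}\bigl(4t/(3\alpha_\ell\varepsilon)\bigr)$ noise is added to every unpruned node, and infinite noise to the pruned ones. 3. A pruned node that lies $d$ levels below its group root receives the noisy value of the group root divided by $f^{d}$. The resulting tree $\hat T$ is published. *Claim.* For every histogram algorithm $F$: (a) for every fixed permissible grouping, the Hierarchy Level module of level $\ell$ is $\frac{3\alpha_\ell\varepsilon}{4t}$-differentially private; (b) whenever the Smoothing module is any $\varepsilon/4$-differentially private mechanism that outputs permissible grouping strategies (whatever the error metric), the scheme, that is the publication of $\hat T$, is $\varepsilon$-differentially private; (c) with the squared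 error metric, the Smoothing module is $\varepsilon/4$-differentially private and the scheme is $\varepsilon$-differentially private; (d) with the squared error metric (with or without the optional reduction of the costs), $\hat T$ is computed in $O(n)$ time: there are one program of a real random-access machine (unit-cost arithmetic, comparisons, indirect memory accesses, and draws of Laplace variates with a computed scale) and one constant $C$ such that, for all $n,f,\varepsilon,\alpha$ as above, there is a tie-breaking rule for which, on every input $h$ and for every outcome of its draws, the program halts within $Cn$ steps, and its output has exactly the law of $\hat T$. -/

import Mathlib

open MeasureTheory

noncomputable section

namespace SubtreeSmoothing

/-! ### Histograms and differential privacy -/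

/-- A histogram algorithm maps a dataset (a finite multiset of records) to a vector of `n` counts,
in such a way that every record increments at most a single bin, and by `1`. -/
def IsHistogramAlgorithm {R : Type*} {n : ℕ} (F : Multiset R → Fin n → ℕ) : Prop :=
  ∀ (D : Multiset R) (r : R), F (r ::ₘ D) = F D ∨ ∃ i, F (r ::ₘ D) = F D + Pi.single i 1

/-- `ε`-differential privacy of a mechanism `M` (the law of the output, as a function of the
histogram) for the histogram algorithm `F`. Neighbouring datasets differ in the removal of one
record; the inequality is required in both directions. -/
def IsDP {R Ω : Type*} [MeasurableSpace Ω] {n : ℕ} (F : Multiset R → Fin n → ℕ) (ε : ℝ)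
    (M : (Fin n → ℕ) → Measure Ω) : Prop :=
  ∀ (D : Multiset R) (r : R) (S : Set Ω), MeasurableSet S →
    M (F (r ::ₘ D)) S ≤ ENNReal.ofReal (Real.exp ε) * M (F D) S ∧
    M (F D) S ≤ ENNReal.ofReal (Real.exp ε) * M (F (r ::ₘ D)) S

/-- The zero-mean Laplace distribution with scale `b > 0`. -/
def laplace (b : ℝ) : Measure ℝ :=
  volume.withDensity (fun x => ENNReal.ofReal (Real.exp (-|x| / b) / (2 * b)))

/-! ### The aggregate tree

Level `k = 0` holds the leaves (the bins) and the top level `k = height n f - 1` holds the root.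
Node `j` of level `k` is the parent of the nodes `j * f, …, j * f + f - 1` of level `k - 1`, as far
as these exist (`n` need not be a power of `f`). -/

/-- The number of levels of the aggregate tree with fan-out `f` over `n` bins. -/
def height (n f : ℕ) : ℕ := Nat.clog f n + 1

/-- The number of nodes in level `k`, that is `⌈n / f ^ k⌉`. -/
def levelSize (n f k : ℕ) : ℕ := (n + f ^ k - 1) / f ^ k

/-- A node is a level together with a position in the level. -/
abbrev Node (n f : ℕ) : Type := Σ k : Fin (height n f), Fin (levelSize n f k)

/-- The bins that are leaves of the subtree rooted at `v`. -/
def leaves {n f : ℕ} (v : Node n f) : Finset (Fin n) :=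
  Finset.univ.filter (fun i => (i : ℕ) / f ^ (v.1 : ℕ) = (v.2 : ℕ))

/-- The subtree rooted at `v` is full: none of its `f ^ k` possible leaves is missing. -/
def IsFull {n f : ℕ} (v : Node n f) : Prop := (leaves v).card = f ^ (v.1 : ℕ)

/-- `r` is a proper ancestor of `v`. -/
def IsAncestor {n f : ℕ} (r v : Node n f) : Prop :=
  (v.1 : ℕ) < r.1 ∧ (v.2 : ℕ) / f ^ ((r.1 : ℕ) - v.1) = r.2

/-- Level `k` of the aggregate tree of `h`, as a histogram. -/
def levelHistogram {n f : ℕ} (h : Fin n → ℕ) (k : Fin (height n f)) :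
    Fin (levelSize n f k) → ℝ :=
  fun j => ∑ i ∈ leaves (⟨k, j⟩ : Node n f), (h i : ℝ)

/-! ### The Smoothing module -/

/-- A permissible grouping strategy: a partition of the bins, each of whose groups is the leaf set
of a full subtree of the aggregate tree. -/
def Grouping (n f : ℕ) : Type :=
  {P : Finpartition (Finset.univ : Finset (Fin n)) //
    ∀ g ∈ P.parts, ∃ v : Node n f, IsFull v ∧ leaves v = g}

instance (n f : ℕ) : MeasurableSpace (Grouping n f) := ⊤

/-- The average of the bins in `g`. -/
def groupAvg {n : ℕ} (b : Fin n → ℝ) (g : Finset (Fin n)) : ℝ := (∑ i ∈ g, b i) / g.card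

/-- The budget of the Grouping submodule. -/
def groupingBudget (ε : ℝ) : ℝ := ε / 4

/-- The value `v_i`, the same for all permissible groups. -/
def groupError (n f : ℕ) (ε : ℝ) : ℝ := 4 * (height n f : ℝ) / (3 * ε)

/-- The squared-error cost of a group on the noisy histogram `b`. If `debias` is set, the expected
increase of the cost that is caused by the noise in `b` is subtracted. -/
def groupCost {n : ℕ} (f : ℕ) (ε : ℝ) (debias : Bool) (b : Fin n → ℝ) (g : Finset (Fin n)) : ℝ :=
  ∑ i ∈ g, (b i - groupAvg b g) ^ 2 + groupError n f ε ^ 2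
    - (if debias then 2 * ((g.card : ℝ) - 1) / groupingBudget ε ^ 2 else 0)

/-- The squared error of a grouping strategy. -/
def groupingCost {n f : ℕ} (ε : ℝ) (debias : Bool) (b : Fin n → ℝ) (P : Grouping n f) : ℝ :=
  ∑ g ∈ P.1.parts, groupCost f ε debias b g

/-- `sel` selects, for every noisy histogram, a permissible grouping strategy that minimizes the
squared error (ties may be broken in any measurable way). -/
def IsOptimalSelection {n f : ℕ} (ε : ℝ) (debias : Bool) (sel : (Fin n → ℝ) → Grouping n f) :
    Prop :=
  Measurable sel ∧ ∀ (b : Fin n → ℝ) (P : Grouping n f),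
    groupingCost ε debias b (sel b) ≤ groupingCost ε debias b P

/-- The Smoothing module for the squared error metric, without Ordering and with no budget for its
Noise Addition (so that only the grouping is published): Laplace noise with scale
`1 / (ε / 4)` is added to every bin, and a strategy is selected on the noisy bins. -/
def smoothing {n f : ℕ} (ε : ℝ) (sel : (Fin n → ℝ) → Grouping n f) (h : Fin n → ℕ) :
    Measure (Grouping n f) :=
  (Measure.pi (fun i => (laplace (1 / groupingBudget ε)).map (fun z => (h i : ℝ) + z))).map sel

/-! ### Pruning and the Hierarchy Level modules -/

/-- The node `r` is a group root of `P`. -/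
def IsGroupRoot {n f : ℕ} (P : Grouping n f) (r : Node n f) : Prop :=
  IsFull r ∧ leaves r ∈ P.1.parts

/-- The node `v` is pruned: it lies strictly below a group root. -/
def IsPruned {n f : ℕ} (P : Grouping n f) (v : Node n f) : Prop :=
  ∃ r, IsGroupRoot P r ∧ IsAncestor r v

open Classical in
/-- The scalars that the first connector assigns to the nodes of level `k`. -/
def scalars {n f : ℕ} (P : Grouping n f) (k : Fin (height n f)) : Fin (levelSize n f k) → ℝ :=
  fun j => if IsPruned P ⟨k, j⟩ then 0 else 1

open Classical in
/-- The Hierarchy Level module on a histogram `x` with budget `ε'`, level parameter `a` and scalars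
`L`: independent Laplace noise with scale `1 / (a * ε' * L j)` is added to bin `j`; where `L j = 0`
the noise is infinite. -/
def hierarchyLevel {m : ℕ} (ε' a : ℝ) (L x : Fin m → ℝ) : Measure (Fin m → EReal) :=
  Measure.pi (fun j =>
    if L j = 0 then Measure.dirac ⊤
    else (laplace (1 / (a * ε' * L j))).map (fun z => ((x j + z : ℝ) : EReal)))

/-- The budget of each Hierarchy Level module: `3 ε / 4`, split evenly over the levels. -/
def levelBudget (n f : ℕ) (ε : ℝ) : ℝ := (3 * ε / 4) / height n f

/-- The output of the `k`-th Hierarchy Level module, given the grouping. -/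
def levelOutput {n f : ℕ} (ε : ℝ) (α : Fin (height n f) → ℝ) (P : Grouping n f)
    (k : Fin (height n f)) (h : Fin n → ℕ) : Measure (Fin (levelSize n f k) → EReal) :=
  hierarchyLevel (levelBudget n f ε) (α k) (scalars P k) (levelHistogram h k)

/-! ### The scheme -/

/-- A tree with real values in its nodes, given by its levels. -/
abbrev Tree (n f : ℕ) : Type := (k : Fin (height n f)) → Fin (levelSize n f k) → ℝ

open Classical in
/-- The second connector assembles the noisy levels to a tree; a pruned node receives its share of
the value of its group root `r`, which is distributed evenly over the `f ^ d` nodes that lie `d`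
levels below `r` in the subtree of `r`. -/
def assemble {n f : ℕ} (P : Grouping n f)
    (y : (k : Fin (height n f)) → Fin (levelSize n f k) → EReal) : Tree n f :=
  fun k j =>
    if hp : IsPruned P ⟨k, j⟩ then
      (y hp.choose.1 hp.choose.2).toReal / (f : ℝ) ^ ((hp.choose.1 : ℕ) - k)
    else (y k j).toReal

/-- The law of the noisy tree, given the grouping. -/
def treeGiven {n f : ℕ} (ε : ℝ) (α : Fin (height n f) → ℝ) (h : Fin n → ℕ) (P : Grouping n f) :
    Measure (Tree n f) :=
  (Measure.pi (fun k => levelOutput ε α P k h)).map (assemble P)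

/-- The Subtree Smoothing scheme with Smoothing module `Q`: the law of the published tree. -/
def scheme {n f : ℕ} (ε : ℝ) (α : Fin (height n f) → ℝ)
    (Q : (Fin n → ℕ) → Measure (Grouping n f)) (h : Fin n → ℕ) : Measure (Tree n f) :=
  (Q h).bind (treeGiven ε α h)

/-! ### A randomized real random-access machine with unit-cost steps

The memory consists of arrays of integers and arrays of reals (unbounded, zero by default), with
indirect addressing. A program names only finitely many of the arrays. Integer arithmetic has
addition, truncated subtraction and multiplication; real arithmetic has the four operations. Every
operation, memory access, comparison and random draw costs one step. -/

/-- The memory, and the number of random draws made so far. -/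
structure State where
  ints : ℕ → ℕ → ℕ
  reals : ℕ → ℕ → ℝ
  draws : ℕ

/-- Integer expressions; `load a i` reads cell `i` of the integer array `a`. -/
inductive NExpr where
  | const (c : ℕ)
  | load (a : ℕ) (i : NExpr)
  | add (x y : NExpr)
  | sub (x y : NExpr)
  | mul (x y : NExpr)

/-- Real expressions; `load a i` reads cell `i` of the real array `a`. -/
inductive RExpr where
  | cast (x : NExpr)
  | load (a : ℕ) (i : NExpr)
  | add (x y : RExpr)
  | sub (x y : RExpr)
  | mul (x y : RExpr)
  | div (x y : RExpr)

/-- Tests. -/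
inductive Test where
  | natLe (x y : NExpr)
  | realLe (x y : RExpr)
  | neg (p : Test)
  | conj (p q : Test)

/-- Programs. `draw a i x` stores a fresh Laplace variate with scale `x` in a real cell. -/
inductive Prog where
  | setInt (a : ℕ) (i x : NExpr)
  | setReal (a : ℕ) (i : NExpr) (x : RExpr)
  | draw (a : ℕ) (i : NExpr) (x : RExpr)
  | seq (p q : Prog)
  | ite (c : Test) (p q : Prog)
  | loop (c : Test) (p : Prog)

def NExpr.eval (s : State) : NExpr → ℕ
  | .const c => c
  | .load a i => s.ints a (i.eval s)
  | .add x y => x.eval s + y.eval s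
  | .sub x y => x.eval s - y.eval s
  | .mul x y => x.eval s * y.eval s

def NExpr.cost : NExpr → ℕ
  | .const _ => 1
  | .load _ i => i.cost + 1
  | .add x y => x.cost + y.cost + 1
  | .sub x y => x.cost + y.cost + 1
  | .mul x y => x.cost + y.cost + 1

def RExpr.eval (s : State) : RExpr → ℝ
  | .cast x => (x.eval s : ℝ)
  | .load a i => s.reals a (i.eval s)
  | .add x y => x.eval s + y.eval s
  | .sub x y => x.eval s - y.eval s
  | .mul x y => x.eval s * y.eval s
  | .div x y => x.eval s / y.eval s

def RExpr.cost : RExpr → ℕ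
  | .cast x => x.cost + 1
  | .load _ i => i.cost + 1
  | .add x y => x.cost + y.cost + 1
  | .sub x y => x.cost + y.cost + 1
  | .mul x y => x.cost + y.cost + 1
  | .div x y => x.cost + y.cost + 1

def Test.eval (s : State) : Test → Prop
  | .natLe x y => x.eval s ≤ y.eval s
  | .realLe x y => x.eval s ≤ y.eval s
  | .neg p => ¬ p.eval s
  | .conj p q => p.eval s ∧ q.eval s

def Test.cost : Test → ℕ
  | .natLe x y => x.cost + y.cost + 1
  | .realLe x y => x.cost + y.cost + 1
  | .neg p => p.cost + 1
  | .conj p q => p.cost + q.cost + 1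

def State.setInt (s : State) (a i v : ℕ) : State :=
  { s with ints := Function.update s.ints a (Function.update (s.ints a) i v) }

def State.setReal (s : State) (a i : ℕ) (v : ℝ) : State :=
  { s with reals := Function.update s.reals a (Function.update (s.reals a) i v) }

/-- `Runs ω p s s' T`: with the stream `ω` of standard Laplace variates, the program `p` started in
`s` halts in `s'` after `T` steps. A draw with scale `x` multiplies the next variate by `x`. -/
inductive Runs (ω : ℕ → ℝ) : Prog → State → State → ℕ → Prop where
  | setInt (a : ℕ) (i x : NExpr) (s : State) :
      Runs ω (.setInt a i x) s (s.setInt a (i.eval s) (x.eval s)) (i.cost + x.cost + 1)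
  | setReal (a : ℕ) (i : NExpr) (x : RExpr) (s : State) :
      Runs ω (.setReal a i x) s (s.setReal a (i.eval s) (x.eval s)) (i.cost + x.cost + 1)
  | draw (a : ℕ) (i : NExpr) (x : RExpr) (s : State) :
      Runs ω (.draw a i x) s
        { s.setReal a (i.eval s) (x.eval s * ω s.draws) with draws := s.draws + 1 }
        (i.cost + x.cost + 1)
  | seq {p q : Prog} {s s' s'' : State} {T T' : ℕ} :
      Runs ω p s s' T → Runs ω q s' s'' T' → Runs ω (.seq p q) s s'' (T + T')
  | iteTrue {c : Test} {p q : Prog} {s s' : State} {T : ℕ} :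
      c.eval s → Runs ω p s s' T → Runs ω (.ite c p q) s s' (c.cost + T + 1)
  | iteFalse {c : Test} {p q : Prog} {s s' : State} {T : ℕ} :
      ¬ c.eval s → Runs ω q s s' T → Runs ω (.ite c p q) s s' (c.cost + T + 1)
  | loopDone {c : Test} {p : Prog} {s : State} :
      ¬ c.eval s → Runs ω (.loop c p) s s (c.cost + 1)
  | loopStep {c : Test} {p : Prog} {s s' s'' : State} {T T' : ℕ} :
      c.eval s → Runs ω p s s' T → Runs ω (.loop c p) s' s'' T' →
      Runs ω (.loop c p) s s'' (c.cost + T + T' + 1)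

/-- The input in memory: `n` and `f` in cell `0` of the integer arrays `0` and `1`; `ε` in cell `0`
of the real array `0`; `α` in the real array `1`; the histogram in the real array `2`. -/
def initState {n f : ℕ} (ε : ℝ) (α : Fin (height n f) → ℝ) (h : Fin n → ℕ) : State where
  ints := fun a i => if a = 0 ∧ i = 0 then n else if a = 1 ∧ i = 0 then f else 0
  reals := fun a i =>
    if a = 0 ∧ i = 0 then ε
    else if a = 1 then (if hi : i < height n f then α ⟨i, hi⟩ else 0)
    else if a = 2 then (if hi : i < n then (h ⟨i, hi⟩ : ℝ) else 0)
    else 0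
  draws := 0

/-- The published tree, read level by level, the leaves first, from the real array `3`. -/
def outputTree (n f : ℕ) (s : State) : Tree n f :=
  fun k j => s.reals 3 (∑ k' ∈ Finset.range k, levelSize n f k' + j)

/-- On the given input, `p` always halts within `T` steps, and the tree that it outputs has the law
`μ` when the random draws are independent. -/
def SamplesWithin {n f : ℕ} (p : Prog) (ε : ℝ) (α : Fin (height n f) → ℝ) (h : Fin n → ℕ)
    (T : ℕ) (μ : Measure (Tree n f)) : Prop :=
  ∃ out : (ℕ → ℝ) → Tree n f,
    (∀ ω, ∃ s' T', Runs ω p (initState ε α h) s' T' ∧ T' ≤ T ∧ outputTree n f s' = out ω) ∧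
    Measurable out ∧
    (Measure.infinitePi (fun _ : ℕ => laplace 1)).map out = μ

end SubtreeSmoothing

end

open SubtreeSmoothing

/-! The privacy part is composition. Laws are compared by `μ ≤ exp ε • ν`; this relation survives
post-processing, and its exponents add up over products and kernels (`map_le_exp_smul`,
`pi_le_exp_smul`, `bind_le_exp_smul`). Shifting a Laplace variate multiplies its density by a bounded
factor (`map_add_laplace_le`), and a record changes one node per level only, because the nodes of a
level have disjoint leaf sets (`sum_abs_levelHistogram_le`). So level `k` spends
`α k * levelBudget`, all levels together spend `3 * ε / 4`, and the Smoothing module the rest.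

An optimal grouping is found bottom-up. The cost of a strategy is spread evenly over the bins of each
group, so that restricting it to the bins below a node makes sense for every node, full or not. The
least cost below a node is the sum over its children or, for a full node, possibly the cost of a
single group. A full node whose own cost is at most the sum for its children is flagged, and the
topmost flagged nodes are the group roots of an optimal strategy (`bestCost_le_sum_share`,
`sum_share_groupingOf`). This rule `optSel` is the tie-breaking rule of the program.

The program numbers the nodes level by level, so that a node precedes its parent. After the noise of
the bins is drawn, one loop visits the nodes in this order and adds the number of leaves, the sums
of the bins, of the noisy bins and of their squares, and the optimal costs to the accumulators of the
parent (`Acc`); the squared error of a group is a function of these sums (`groupCost_eq`). The same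
loop draws the noise of every node, pruned or not, so that the `m`-th variate always has the same
role. A last loop in the opposite order lets each node below a flagged or pruned parent inherit its
share of the value of the parent (`assemble_of_isPruned`). There are at most `3 * n` nodes
(`offset_height_le`), and every loop body has constant cost.

The output is thus a function of finitely many independent variates. Given the variates of the bins,
the variates of the nodes yield the law `treeGiven` of the tree for the selected grouping, in which
the superfluous variates do not matter (`assemble_congr`). Integrating gives the law of the scheme
(`map_outTree`). -/

noncomputable section

namespace SubtreeSmoothing

/-! ### The Laplace distribution -/

lemma lintegral_laplace_one :
    ∫⁻ x, ENNReal.ofReal (Real.exp (-|x| / 1) / (2 * 1)) ∂(volume : Measure ℝ) = 1 := by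
  have h3 : ∫ x : ℝ, Real.exp (-|x|) = 2 := by
    rw [integral_comp_abs (f := fun x : ℝ => Real.exp (-x)), integral_exp_neg_Ioi_zero]; norm_num
  have h2 : Integrable (fun x : ℝ => Real.exp (-|x|)) :=
    not_imp_comm.1 integral_undef (by rw [h3]; norm_num)
  have hi : Integrable (fun x : ℝ => Real.exp (-|x| / 1) / (2 * 1)) := by
    simpa using h2.div_const 2
  rw [← ofReal_integral_eq_lintegral_ofReal hi (ae_of_all _ fun x => by positivity)]
  simp [integral_div, h3]

instance isProbabilityMeasure_laplace_one : IsProbabilityMeasure (laplace 1) :=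
  ⟨by rw [laplace, withDensity_apply _ MeasurableSet.univ, Measure.restrict_univ,
        lintegral_laplace_one]⟩

lemma measurable_laplace_density (b x : ℝ) :
    Measurable (fun y : ℝ => ENNReal.ofReal (Real.exp (-|y - x| / b) / (2 * b))) := by
  fun_prop

/-- A Laplace variate is a rescaled standard Laplace variate. -/
lemma map_mul_laplace_one {b : ℝ} (hb : 0 < b) : (laplace 1).map (fun z => b * z) = laplace b := by
  ext S hS
  have hm : Measurable (fun z : ℝ => b * z) := by fun_prop
  rw [Measure.map_apply hm hS, laplace, laplace, withDensity_apply _ (hm hS),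
    withDensity_apply _ hS]
  nth_rw 2 [← Real.smul_map_volume_mul_left hb.ne']
  rw [Measure.restrict_smul, lintegral_smul_measure, setLIntegral_map hS (by fun_prop) hm,
    smul_eq_mul, ← lintegral_const_mul' _ _ ENNReal.ofReal_ne_top]
  refine lintegral_congr fun z => ?_
  rw [← ENNReal.ofReal_mul (abs_nonneg _), abs_mul, abs_of_pos hb]
  congr 1
  have : -(b * |z|) / b = -|z| / 1 := by field_simp
  rw [this]
  field_simp

lemma isProbabilityMeasure_laplace {b : ℝ} (hb : 0 < b) : IsProbabilityMeasure (laplace b) := by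
  rw [← map_mul_laplace_one hb]
  exact Measure.isProbabilityMeasure_map (by fun_prop)

lemma map_add_laplace (b x : ℝ) : (laplace b).map (fun z => x + z) =
    volume.withDensity (fun y => ENNReal.ofReal (Real.exp (-|y - x| / b) / (2 * b))) := by
  ext S hS
  have hm : Measurable (fun z : ℝ => x + z) := by fun_prop
  rw [Measure.map_apply hm hS, laplace, withDensity_apply _ (hm hS), withDensity_apply _ hS,
    ← (measurePreserving_add_left (volume : Measure ℝ) x).map_eq,
    setLIntegral_map hS (measurable_laplace_density b x) hm]
  simp [map_add_left_eq_self]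

/-- Shifting a Laplace variate changes its density by a bounded factor. -/
lemma map_add_laplace_le {b : ℝ} (hb : 0 < b) (x x' : ℝ) :
    (laplace b).map (fun z => x + z) ≤
      ENNReal.ofReal (Real.exp (|x - x'| / b)) • (laplace b).map (fun z => x' + z) := by
  rw [map_add_laplace, map_add_laplace, ← withDensity_smul _ (measurable_laplace_density b x')]
  refine withDensity_mono (ae_of_all _ fun y => ?_)
  simp only [Pi.smul_apply, smul_eq_mul]
  rw [← ENNReal.ofReal_mul (Real.exp_nonneg _), ← mul_div_assoc, ← Real.exp_add, ← add_div]
  gcongr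
  linarith [abs_sub_le y x x', abs_sub_comm x x']

/-! ### Multiplicative domination of measures -/

lemma le_exp_smul_self {Ω : Type*} [MeasurableSpace Ω] (μ : Measure Ω) {c : ℝ} (hc : 0 ≤ c) :
    μ ≤ ENNReal.ofReal (Real.exp c) • μ := by
  refine Measure.le_iff.2 fun S _ => ?_
  rw [Measure.smul_apply, smul_eq_mul]
  refine le_mul_of_one_le_left zero_le ?_
  rw [← ENNReal.ofReal_one]
  exact ENNReal.ofReal_le_ofReal (Real.one_le_exp hc)

lemma exp_smul_mono {Ω : Type*} [MeasurableSpace Ω] {μ ν : Measure Ω} {c d : ℝ} (hcd : c ≤ d)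
    (h : μ ≤ ENNReal.ofReal (Real.exp c) • ν) : μ ≤ ENNReal.ofReal (Real.exp d) • ν := by
  refine h.trans (Measure.le_iff.2 fun S _ => ?_)
  simp only [Measure.smul_apply, smul_eq_mul]
  gcongr

/-- Post-processing. -/
lemma map_le_exp_smul {Ω Ω' : Type*} [MeasurableSpace Ω] [MeasurableSpace Ω'] {μ ν : Measure Ω}
    {c : ℝ} {g : Ω → Ω'} (hg : Measurable g) (h : μ ≤ ENNReal.ofReal (Real.exp c) • ν) :
    μ.map g ≤ ENNReal.ofReal (Real.exp c) • ν.map g := by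
  rw [← Measure.map_smul]
  exact Measure.map_mono h hg

/-- Parallel and sequential composition of independent mechanisms: the exponents add up. -/
lemma pi_le_exp_smul {ι : Type*} [Fintype ι] {Ω : ι → Type*} [∀ i, MeasurableSpace (Ω i)]
    {μ ν : (i : ι) → Measure (Ω i)} [∀ i, SigmaFinite (μ i)] [∀ i, SigmaFinite (ν i)]
    {c : ι → ℝ} (h : ∀ i, μ i ≤ ENNReal.ofReal (Real.exp (c i)) • ν i) :
    Measure.pi μ ≤ ENNReal.ofReal (Real.exp (∑ i, c i)) • Measure.pi ν := by
  set C := ENNReal.ofReal (Real.exp (∑ i, c i)) with hC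
  have hC0 : C ≠ 0 := by simp [hC, Real.exp_pos]
  have hCt : C ≠ ⊤ := ENNReal.ofReal_ne_top
  have hCprod : C = ∏ i, ENNReal.ofReal (Real.exp (c i)) := by
    rw [hC, Real.exp_sum, ENNReal.ofReal_prod_of_nonneg fun i _ => Real.exp_nonneg _]
  have key : (C⁻¹ • Measure.pi μ).toOuterMeasure ≤
      OuterMeasure.pi (fun i => (ν i).toOuterMeasure) := by
    refine OuterMeasure.le_pi.2 fun s _ => ?_
    change (C⁻¹ • Measure.pi μ) (Set.univ.pi s) ≤ ∏ i, ν i (s i)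
    rw [Measure.smul_apply, Measure.pi_pi, smul_eq_mul]
    calc C⁻¹ * ∏ i, μ i (s i) ≤ C⁻¹ * ∏ i, (ENNReal.ofReal (Real.exp (c i)) * ν i (s i)) := by
          gcongr with i; exact h i (s i)
      _ = ∏ i, ν i (s i) := by
          rw [Finset.prod_mul_distrib, ← hCprod, ← mul_assoc, ENNReal.inv_mul_cancel hC0 hCt,
            one_mul]
  refine Measure.le_iff.2 fun S hS => ?_
  have h1 : C⁻¹ * Measure.pi μ S ≤ Measure.pi ν S := by
    rw [show Measure.pi ν S = OuterMeasure.pi (fun i => (ν i).toOuterMeasure) S by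
      rw [Measure.pi, toMeasure_apply _ _ hS]]
    have := key S
    rwa [Measure.coe_toOuterMeasure, Measure.smul_apply, smul_eq_mul] at this
  rw [Measure.smul_apply, smul_eq_mul]
  calc Measure.pi μ S = C * (C⁻¹ * Measure.pi μ S) := by
        rw [← mul_assoc, ENNReal.mul_inv_cancel hC0 hCt, one_mul]
    _ ≤ C * Measure.pi ν S := by gcongr

/-- Adaptive composition. -/
lemma bind_le_exp_smul {Ω Ω' : Type*} [MeasurableSpace Ω] [MeasurableSpace Ω'] {μ ν : Measure Ω}
    {κ η : Ω → Measure Ω'} (hκ : Measurable κ) (hη : Measurable η) {c d : ℝ}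
    (h : μ ≤ ENNReal.ofReal (Real.exp c) • ν)
    (h' : ∀ x, κ x ≤ ENNReal.ofReal (Real.exp d) • η x) :
    μ.bind κ ≤ ENNReal.ofReal (Real.exp (c + d)) • ν.bind η := by
  refine Measure.le_iff.2 fun S hS => ?_
  rw [Measure.smul_apply, smul_eq_mul, Measure.bind_apply hS hκ.aemeasurable,
    Measure.bind_apply hS hη.aemeasurable]
  calc ∫⁻ x, κ x S ∂μ
      ≤ ∫⁻ x, ENNReal.ofReal (Real.exp d) * η x S ∂(ENNReal.ofReal (Real.exp c) • ν) :=
        lintegral_mono' h fun x => h' x S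
    _ = _ := by
        rw [lintegral_smul_measure, lintegral_const_mul' _ _ ENNReal.ofReal_ne_top, smul_eq_mul,
          ← mul_assoc, Real.exp_add, ENNReal.ofReal_mul (Real.exp_nonneg _)]

/-! ### Privacy -/

/-- Two histograms are close if they differ by at most one record. -/
def IsClose {n : ℕ} (h h' : Fin n → ℕ) : Prop := ∑ i, |(h i : ℝ) - h' i| ≤ 1

lemma IsClose.symm {n : ℕ} {h h' : Fin n → ℕ} (hh : IsClose h h') : IsClose h' h := by
  simpa only [IsClose, abs_sub_comm] using hh

lemma IsHistogramAlgorithm.isClose {R : Type*} {n : ℕ} {F : Multiset R → Fin n → ℕ}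
    (hF : IsHistogramAlgorithm F) (D : Multiset R) (r : R) : IsClose (F (r ::ₘ D)) (F D) := by
  rcases hF D r with h | ⟨i, h⟩
  · simp [IsClose, h]
  · rw [IsClose, h, Finset.sum_eq_single i]
    · simp
    · intro j _ hj; simp [hj]
    · simp

/-- A mechanism is private if its laws on close histograms dominate each other. -/
lemma isDP_of_isClose {R Ω : Type*} [MeasurableSpace Ω] {n : ℕ} {F : Multiset R → Fin n → ℕ}
    (hF : IsHistogramAlgorithm F) {ε : ℝ} {M : (Fin n → ℕ) → Measure Ω}
    (hM : ∀ h h', IsClose h h' → M h ≤ ENNReal.ofReal (Real.exp ε) • M h') : IsDP F ε M :=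
  fun D r S _ => ⟨hM _ _ (hF.isClose D r) S, hM _ _ (hF.isClose D r).symm S⟩

lemma IsDP.le_smul {R Ω : Type*} [MeasurableSpace Ω] {n : ℕ} {F : Multiset R → Fin n → ℕ}
    {ε : ℝ} {M : (Fin n → ℕ) → Measure Ω} (hM : IsDP F ε M) (D : Multiset R) (r : R) :
    M (F (r ::ₘ D)) ≤ ENNReal.ofReal (Real.exp ε) • M (F D) ∧
      M (F D) ≤ ENNReal.ofReal (Real.exp ε) • M (F (r ::ₘ D)) :=
  ⟨Measure.le_iff.2 fun S hS => (hM D r S hS).1, Measure.le_iff.2 fun S hS => (hM D r S hS).2⟩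

/-- The nodes of a level have disjoint sets of leaves, so that a record counts only once. -/
lemma sum_abs_levelHistogram_le {n f : ℕ} {h h' : Fin n → ℕ} (hh : IsClose h h')
    (k : Fin (height n f)) :
    ∑ j, |levelHistogram h k j - levelHistogram h' k j| ≤ 1 := by
  refine le_trans ?_ hh
  calc ∑ j, |levelHistogram h k j - levelHistogram h' k j|
      ≤ ∑ j, ∑ i ∈ leaves (⟨k, j⟩ : Node n f), |(h i : ℝ) - h' i| := by
        refine Finset.sum_le_sum fun j _ => ?_
        rw [levelHistogram, levelHistogram, ← Finset.sum_sub_distrib]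
        exact Finset.abs_sum_le_sum_abs _ _
    _ = ∑ i : Fin n, ∑ j : Fin (levelSize n f k),
          if (i : ℕ) / f ^ (k : ℕ) = (j : ℕ) then |(h i : ℝ) - h' i| else 0 := by
        rw [Finset.sum_comm]
        simp only [leaves, Finset.sum_filter]
    _ ≤ ∑ i, |(h i : ℝ) - h' i| := by
        refine Finset.sum_le_sum fun i _ => ?_
        rw [← Finset.sum_filter, Finset.sum_const]
        refine smul_le_of_le_one_left (abs_nonneg _) (Finset.card_le_one.2 ?_)
        intro a ha b hb
        simp only [Finset.mem_filter, Finset.mem_univ, true_and] at ha hb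
        exact Fin.ext (ha.symm.trans hb)

section Level

variable {n f : ℕ} {ε : ℝ} {α : Fin (height n f) → ℝ}

lemma height_pos (n f : ℕ) : 0 < (height n f : ℝ) := by
  simp only [height]; positivity

lemma levelBudget_pos (hε : 0 < ε) : 0 < levelBudget n f ε :=
  div_pos (by linarith) (height_pos n f)

lemma isProbabilityMeasure_hierarchyLevel_factor {a ε' l x : ℝ} (ha : 0 < a) (hε : 0 < ε')
    (hl : l = 0 ∨ l = 1) : IsProbabilityMeasure
      (open Classical in if l = 0 then (Measure.dirac (⊤ : EReal))
        else (laplace (1 / (a * ε' * l))).map (fun z => ((x + z : ℝ) : EReal))) := by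
  rcases hl with rfl | rfl
  · simp only [if_true]; infer_instance
  · rw [if_neg one_ne_zero]
    have := isProbabilityMeasure_laplace (b := 1 / (a * ε' * 1)) (by positivity)
    exact Measure.isProbabilityMeasure_map (by fun_prop)

lemma scalars_eq_zero_or_one (P : Grouping n f) (k : Fin (height n f))
    (j : Fin (levelSize n f k)) : scalars P k j = 0 ∨ scalars P k j = 1 := by
  unfold scalars; split <;> simp

lemma isProbabilityMeasure_levelOutput (hε : 0 < ε) (hα : ∀ k, 0 < α k) (P : Grouping n f)
    (k : Fin (height n f)) (h : Fin n → ℕ) : IsProbabilityMeasure (levelOutput ε α P k h) := by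
  have := fun j => isProbabilityMeasure_hierarchyLevel_factor (x := levelHistogram h k j)
    (hα k) (levelBudget_pos (n := n) (f := f) hε) (scalars_eq_zero_or_one P k j)
  unfold levelOutput hierarchyLevel
  infer_instance

lemma levelOutput_le (hε : 0 < ε) (hα : ∀ k, 0 < α k) (P : Grouping n f)
    (k : Fin (height n f)) {h h' : Fin n → ℕ} (hh : IsClose h h') :
    levelOutput ε α P k h ≤
      ENNReal.ofReal (Real.exp (α k * levelBudget n f ε)) • levelOutput ε α P k h' := by
  have hb := levelBudget_pos (n := n) (f := f) hε
  have hpos := mul_pos (hα k) hb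
  have i1 := fun j => isProbabilityMeasure_hierarchyLevel_factor (x := levelHistogram h k j)
    (hα k) hb (scalars_eq_zero_or_one P k j)
  have i2 := fun j => isProbabilityMeasure_hierarchyLevel_factor (x := levelHistogram h' k j)
    (hα k) hb (scalars_eq_zero_or_one P k j)
  refine exp_smul_mono (c := ∑ j, |levelHistogram h k j - levelHistogram h' k j| *
    (α k * levelBudget n f ε)) ?_ (pi_le_exp_smul fun j => ?_)
  · rw [← Finset.sum_mul]
    exact mul_le_of_le_one_left hpos.le (sum_abs_levelHistogram_le hh k)
  · rcases scalars_eq_zero_or_one P k j with hs | hs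
    · simp only [hs, if_true]
      exact le_exp_smul_self _ (mul_nonneg (abs_nonneg _) hpos.le)
    · simp only [hs, one_ne_zero, if_false, mul_one]
      have := map_le_exp_smul (g := fun x : ℝ => (x : EReal)) (by fun_prop)
        (map_add_laplace_le (one_div_pos.2 hpos) (levelHistogram h k j) (levelHistogram h' k j))
      rw [Measure.map_map (by fun_prop) (by fun_prop),
        Measure.map_map (by fun_prop) (by fun_prop), div_div_eq_mul_div, div_one] at this
      exact this

lemma measurable_assemble (P : Grouping n f) : Measurable (assemble P) := by
  refine measurable_pi_iff.2 fun k => measurable_pi_iff.2 fun j => ?_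
  unfold assemble
  split_ifs with hp <;> fun_prop

lemma isProbabilityMeasure_treeGiven (hε : 0 < ε) (hα : ∀ k, 0 < α k) (h : Fin n → ℕ)
    (P : Grouping n f) : IsProbabilityMeasure (treeGiven ε α h P) := by
  have := fun k => isProbabilityMeasure_levelOutput hε hα P k h
  exact Measure.isProbabilityMeasure_map (measurable_assemble P).aemeasurable

lemma treeGiven_le (hε : 0 < ε) (hα : ∀ k, 0 < α k) (hsum : ∑ k, α k = (height n f : ℝ))
    (P : Grouping n f) {h h' : Fin n → ℕ} (hh : IsClose h h') :
    treeGiven ε α h P ≤ ENNReal.ofReal (Real.exp (3 * ε / 4)) • treeGiven ε α h' P := by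
  have i1 := fun k => isProbabilityMeasure_levelOutput hε hα P k h
  have i2 := fun k => isProbabilityMeasure_levelOutput hε hα P k h'
  have hc : ∑ k, α k * levelBudget n f ε = 3 * ε / 4 := by
    rw [← Finset.sum_mul, hsum, levelBudget, mul_div_cancel₀ _ (height_pos n f).ne']
  rw [← hc]
  exact map_le_exp_smul (measurable_assemble P)
    (pi_le_exp_smul fun k => levelOutput_le hε hα P k hh)

lemma isProbabilityMeasure_scheme (hε : 0 < ε) (hα : ∀ k, 0 < α k)
    {Q : (Fin n → ℕ) → Measure (Grouping n f)} (h : Fin n → ℕ) (hQ : IsProbabilityMeasure (Q h)) :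
    IsProbabilityMeasure (scheme ε α Q h) := by
  refine ⟨?_⟩
  rw [scheme, Measure.bind_apply MeasurableSet.univ measurable_from_top.aemeasurable]
  have := isProbabilityMeasure_treeGiven hε hα h
  simp

lemma isDP_scheme (hε : 0 < ε) (hα : ∀ k, 0 < α k) (hsum : ∑ k, α k = (height n f : ℝ))
    {R : Type*} {F : Multiset R → Fin n → ℕ} (hF : IsHistogramAlgorithm F)
    {Q : (Fin n → ℕ) → Measure (Grouping n f)} (hQ : IsDP F (ε / 4) Q) :
    IsDP F ε (scheme ε α Q) := by
  intro D r S _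
  have hc : ε = ε / 4 + 3 * ε / 4 := by ring
  have hcl := hF.isClose D r
  constructor
  · have := bind_le_exp_smul measurable_from_top measurable_from_top (hQ.le_smul D r).1
      (fun P => treeGiven_le hε hα hsum P hcl)
    rw [← hc] at this
    exact this S
  · have := bind_le_exp_smul measurable_from_top measurable_from_top (hQ.le_smul D r).2
      (fun P => treeGiven_le hε hα hsum P hcl.symm)
    rw [← hc] at this
    exact this S

lemma isProbabilityMeasure_noisyBin {b : ℝ} (hb : 0 < b) (x : ℝ) :
    IsProbabilityMeasure ((laplace b).map (fun z => x + z)) := by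
  have := isProbabilityMeasure_laplace hb
  exact Measure.isProbabilityMeasure_map (by fun_prop)

lemma isProbabilityMeasure_smoothing (hε : 0 < ε) {sel : (Fin n → ℝ) → Grouping n f}
    (hsel : Measurable sel) (h : Fin n → ℕ) : IsProbabilityMeasure (smoothing ε sel h) := by
  have := fun i => isProbabilityMeasure_noisyBin (b := 1 / groupingBudget ε)
    (by unfold groupingBudget; positivity) (h i : ℝ)
  exact Measure.isProbabilityMeasure_map hsel.aemeasurable

lemma smoothing_le (hε : 0 < ε) {sel : (Fin n → ℝ) → Grouping n f} (hsel : Measurable sel)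
    {h h' : Fin n → ℕ} (hh : IsClose h h') :
    smoothing ε sel h ≤ ENNReal.ofReal (Real.exp (ε / 4)) • smoothing ε sel h' := by
  have hb : 0 < 1 / groupingBudget ε := by unfold groupingBudget; positivity
  have i1 := fun i => isProbabilityMeasure_noisyBin hb (h i : ℝ)
  have i2 := fun i => isProbabilityMeasure_noisyBin hb (h' i : ℝ)
  refine map_le_exp_smul hsel (exp_smul_mono ?_
    (pi_le_exp_smul fun i => map_add_laplace_le hb (h i : ℝ) (h' i : ℝ)))
  rw [← Finset.sum_div, groupingBudget, div_div_eq_mul_div, div_one]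
  exact mul_le_of_le_one_left (by positivity) hh

end Level

/-! ### Nodes as pairs of a level and a position -/

section Nodes

variable {n f : ℕ}

/-- The bins below node `j` of level `k`; unlike `leaves` it makes sense for all pairs of numbers. -/
def leavesAt (n f k j : ℕ) : Finset (Fin n) :=
  Finset.univ.filter (fun i => (i : ℕ) / f ^ k = j)

/-- Node `j` of level `k` exists and its subtree is full. -/
def FullAt (n f k j : ℕ) : Prop := (leavesAt n f k j).card = f ^ k

lemma leaves_eq_leavesAt (v : Node n f) : leaves v = leavesAt n f v.1 v.2 := rfl

@[simp] lemma mem_leavesAt {k j : ℕ} {i : Fin n} :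
    i ∈ leavesAt n f k j ↔ (i : ℕ) / f ^ k = j := by simp [leavesAt]

lemma div_pow_add (i k l : ℕ) : i / f ^ (k + l) = i / f ^ k / f ^ l := by
  rw [pow_add, Nat.div_div_eq_div_mul]

lemma div_pow_succ (i k : ℕ) : i / f ^ (k + 1) = i / f ^ k / f := by
  rw [div_pow_add, pow_one]

lemma div_pow_of_le {k l : ℕ} (h : k ≤ l) (i : ℕ) : i / f ^ l = i / f ^ k / f ^ (l - k) := by
  rw [← div_pow_add, Nat.add_sub_cancel' h]

lemma leavesAt_subset {k l : ℕ} (h : k ≤ l) (j : ℕ) :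
    leavesAt n f k j ⊆ leavesAt n f l (j / f ^ (l - k)) := by
  intro i hi
  rw [mem_leavesAt] at hi ⊢
  rw [div_pow_of_le h, hi]

lemma lt_levelSize (hf : 2 ≤ f) {k j : ℕ} : j < levelSize n f k ↔ j * f ^ k < n := by
  have hp : 0 < f ^ k := by positivity
  rw [levelSize, Nat.lt_iff_add_one_le, Nat.le_div_iff_mul_le hp, add_mul]
  omega

lemma levelSize_zero (n f : ℕ) : levelSize n f 0 = n := by simp [levelSize]

lemma levelSize_pos (hn : 0 < n) (hf : 2 ≤ f) (k : ℕ) : 0 < levelSize n f k :=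
  (lt_levelSize hf).2 (by simpa)

lemma div_lt_levelSize (hf : 2 ≤ f) (k : ℕ) {i : ℕ} (hi : i < n) : i / f ^ k < levelSize n f k :=
  (lt_levelSize hf).2 ((Nat.div_mul_le_self _ _).trans_lt hi)

lemma div_lt_levelSize_add (hf : 2 ≤ f) {k j : ℕ} (l : ℕ) (hj : j < levelSize n f k) :
    j / f ^ l < levelSize n f (k + l) := by
  rw [lt_levelSize hf] at hj ⊢
  refine lt_of_le_of_lt ?_ hj
  rw [pow_add, mul_comm (f ^ k), ← mul_assoc]
  exact Nat.mul_le_mul_right _ (Nat.div_mul_le_self _ _)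

lemma div_lt_levelSize_succ (hf : 2 ≤ f) {k j : ℕ} (hj : j < levelSize n f k) :
    j / f < levelSize n f (k + 1) := by
  simpa using div_lt_levelSize_add hf 1 hj

/-- The last node of a level is below the last node of the next level. -/
lemma levelSize_succ (hn : 0 < n) (hf : 2 ≤ f) (k : ℕ) :
    levelSize n f (k + 1) = (levelSize n f k - 1) / f + 1 := by
  have h0 := levelSize_pos hn hf k
  apply le_antisymm
  · by_contra! h
    have h1 := (lt_levelSize hf).1 h
    rw [pow_succ', ← mul_assoc, ← lt_levelSize hf] at h1
    have h2 := Nat.lt_div_mul_add (a := levelSize n f k - 1) (b := f) (by omega)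
    rw [add_mul, one_mul] at h1
    omega
  · exact div_lt_levelSize_succ hf (by omega)

lemma exists_mem_leavesAt (hf : 2 ≤ f) {k j : ℕ} (hj : j < levelSize n f k) :
    ∃ i, i ∈ leavesAt n f k j :=
  ⟨⟨j * f ^ k, (lt_levelSize hf).1 hj⟩, by
    simp [Nat.mul_div_cancel _ (show 0 < f ^ k by positivity)]⟩

lemma card_leavesAt_le (hf : 2 ≤ f) (k j : ℕ) : (leavesAt n f k j).card ≤ f ^ k := by
  have hp : 0 < f ^ k := by positivity
  rw [← Finset.card_range (f ^ k)]
  refine Finset.card_le_card_of_injOn (fun i => (i : ℕ) % f ^ k)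
    (fun i _ => by simpa using Nat.mod_lt _ hp) ?_
  intro a ha b hb hab
  simp only [Finset.mem_coe, mem_leavesAt] at ha hb
  have h1 := Nat.div_add_mod (a : ℕ) (f ^ k)
  have h2 := Nat.div_add_mod (b : ℕ) (f ^ k)
  simp only at hab
  rw [ha, hab] at h1
  rw [hb] at h2
  exact Fin.ext (h1.symm.trans h2)

lemma fullAt_zero (hf : 2 ≤ f) {j : ℕ} (hj : j < n) : FullAt n f 0 j := by
  obtain ⟨i, hi⟩ := exists_mem_leavesAt (n := n) (k := 0) hf (by rwa [levelSize_zero])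
  have h1 := Finset.card_pos.2 ⟨i, hi⟩
  have h2 := card_leavesAt_le (n := n) hf 0 j
  rw [FullAt, pow_zero] at *
  omega

lemma FullAt.nonempty (hf : 2 ≤ f) {k j : ℕ} (h : FullAt n f k j) : ∃ i, i ∈ leavesAt n f k j :=
  Finset.card_pos.1 (by rw [h]; positivity)

lemma FullAt.lt_levelSize (hf : 2 ≤ f) {k j : ℕ} (h : FullAt n f k j) : j < levelSize n f k := by
  obtain ⟨i, hi⟩ := h.nonempty hf
  rw [← mem_leavesAt.1 hi]
  exact div_lt_levelSize hf k i.2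

lemma FullAt.lt_height (hf : 2 ≤ f) {k j : ℕ} (h : FullAt n f k j) : k < height n f := by
  have h1 : f ^ k ≤ n := by
    rw [← h]; exact (Finset.card_le_univ _).trans (by simp)
  have h2 := h1.trans (Nat.le_pow_clog (by omega : 1 < f) n)
  rw [Nat.pow_le_pow_iff_right (by omega)] at h2
  exact Nat.lt_succ_of_le h2

lemma FullAt.eq_of_leavesAt_eq (hf : 2 ≤ f) {k j k' j' : ℕ} (h : FullAt n f k j)
    (h' : FullAt n f k' j') (he : leavesAt n f k j = leavesAt n f k' j') : k = k' ∧ j = j' := by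
  have hk : k = k' := by
    have : f ^ k = f ^ k' := by rw [← h, ← h', he]
    exact Nat.pow_right_injective hf this
  subst hk
  obtain ⟨i, hi⟩ := h.nonempty hf
  exact ⟨rfl, (mem_leavesAt.1 hi).symm.trans (mem_leavesAt.1 (he ▸ hi))⟩

/-- The leaves of a node are the disjoint union of the leaves of its children. -/
lemma sum_leavesAt_succ {M : Type*} [AddCommMonoid M] (hf : 2 ≤ f) (w : Fin n → M) (k q : ℕ) :
    ∑ i ∈ leavesAt n f (k + 1) q, w i =
      ∑ j ∈ (Finset.range (levelSize n f k)).filter (fun j => j / f = q),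
        ∑ i ∈ leavesAt n f k j, w i := by
  rw [← Finset.sum_fiberwise_of_maps_to (g := fun i : Fin n => (i : ℕ) / f ^ k)
    (t := (Finset.range (levelSize n f k)).filter (fun j => j / f = q))]
  · refine Finset.sum_congr rfl fun j hj => Finset.sum_congr ?_ fun _ _ => rfl
    simp only [Finset.mem_filter] at hj
    ext i
    simp only [Finset.mem_filter, mem_leavesAt, div_pow_succ]
    constructor
    · exact fun h => h.2
    · exact fun h => ⟨by rw [h, hj.2], h⟩
  · intro i hi
    rw [mem_leavesAt, div_pow_succ] at hi
    simp [hi, div_lt_levelSize hf k i.2]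

end Nodes

/-! ### Permissible groupings -/

section Groupings

variable {n f : ℕ}

lemma Grouping.exists_part_eq (P : Grouping n f) (i : Fin n) :
    ∃ k < height n f, FullAt n f k ((i : ℕ) / f ^ k) ∧
      P.1.part i = leavesAt n f k ((i : ℕ) / f ^ k) := by
  obtain ⟨v, hv, he⟩ := P.2 (P.1.part i) (P.1.part_mem.2 (Finset.mem_univ i))
  have hi : i ∈ leavesAt n f v.1 v.2 := by
    rw [← leaves_eq_leavesAt, he]; exact P.1.mem_part (Finset.mem_univ i)
  rw [mem_leavesAt] at hi
  exact ⟨v.1, v.1.2, by rw [hi]; exact hv, by rw [hi]; exact he.symm⟩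

lemma Grouping.eq_of_mem (P : Grouping n f) {g g' : Finset (Fin n)} (hg : g ∈ P.1.parts)
    (hg' : g' ∈ P.1.parts) {i : Fin n} (hi : i ∈ g) (hi' : i ∈ g') : g = g' :=
  P.1.eq_of_mem_parts hg hg' hi hi'

lemma IsAncestor.leaves_subset {r v : Node n f} (h : IsAncestor r v) : leaves v ⊆ leaves r := by
  rw [leaves_eq_leavesAt, leaves_eq_leavesAt, ← h.2]
  exact leavesAt_subset h.1.le _

lemma exists_mem_leaves (hf : 2 ≤ f) (v : Node n f) : ∃ i, i ∈ leaves v :=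
  exists_mem_leavesAt hf v.2.2

lemma node_ext {r r' : Node n f} (h1 : (r.1 : ℕ) = r'.1) (h2 : (r.2 : ℕ) = r'.2) : r = r' := by
  obtain ⟨⟨k, hk⟩, ⟨j, hj⟩⟩ := r
  obtain ⟨⟨k', hk'⟩, ⟨j', hj'⟩⟩ := r'
  simp only at h1 h2
  subst h1; subst h2; rfl

lemma IsGroupRoot.eq_of_mem (hf : 2 ≤ f) {P : Grouping n f} {r r' : Node n f}
    (h : IsGroupRoot P r) (h' : IsGroupRoot P r') {i : Fin n} (hi : i ∈ leaves r)
    (hi' : i ∈ leaves r') : r = r' := by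
  have he := P.eq_of_mem h.2 h'.2 hi hi'
  obtain ⟨h1, h2⟩ := FullAt.eq_of_leavesAt_eq hf h.1 h'.1 he
  exact node_ext h1 h2

lemma IsGroupRoot.not_isPruned (hf : 2 ≤ f) {P : Grouping n f} {r : Node n f}
    (h : IsGroupRoot P r) : ¬ IsPruned P r := by
  rintro ⟨r', h', ha⟩
  obtain ⟨i, hi⟩ := exists_mem_leaves hf r
  have := h.eq_of_mem hf h' hi (ha.leaves_subset hi)
  subst this
  exact lt_irrefl _ ha.1

lemma assemble_of_not_isPruned {P : Grouping n f} {v : Node n f} (h : ¬ IsPruned P v)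
    (y : (k : Fin (height n f)) → Fin (levelSize n f k) → EReal) :
    assemble P y v.1 v.2 = (y v.1 v.2).toReal := by
  rw [assemble, dif_neg h]

lemma assemble_of_isGroupRoot (hf : 2 ≤ f) {P : Grouping n f} {r v : Node n f}
    (h : IsGroupRoot P r) (ha : IsAncestor r v)
    (y : (k : Fin (height n f)) → Fin (levelSize n f k) → EReal) :
    assemble P y v.1 v.2 = (y r.1 r.2).toReal / (f : ℝ) ^ ((r.1 : ℕ) - v.1) := by
  have hp : IsPruned P ⟨v.1, v.2⟩ := ⟨r, h, ha⟩
  obtain ⟨i, hi⟩ := exists_mem_leaves hf v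
  have hr : hp.choose = r := hp.choose_spec.1.eq_of_mem hf h
    (hp.choose_spec.2.leaves_subset hi) (ha.leaves_subset hi)
  rw [assemble, dif_pos hp, hr]

/-- The value of a pruned node is an equal share of the value of its parent. -/
lemma assemble_of_isPruned (hf : 2 ≤ f) {P : Grouping n f} {v p : Node n f}
    (hv : IsPruned P v) (h1 : (p.1 : ℕ) = v.1 + 1) (h2 : (p.2 : ℕ) = v.2 / f)
    (y : (k : Fin (height n f)) → Fin (levelSize n f k) → EReal) :
    assemble P y v.1 v.2 = assemble P y p.1 p.2 / f := by
  obtain ⟨r, hr, ha⟩ := hv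
  rw [assemble_of_isGroupRoot hf hr ha]
  rcases (Nat.succ_le_of_lt ha.1).eq_or_lt with he | hlt
  · have hrp : r = p := by
      refine node_ext (by omega) ?_
      rw [h2, ← ha.2, ← he]; simp
    subst hrp
    rw [assemble_of_not_isPruned (hr.not_isPruned hf), ← he]
    simp
  · have hap : IsAncestor r p := by
      refine ⟨by omega, ?_⟩
      rw [h2, Nat.div_div_eq_div_mul, ← pow_succ', ← ha.2]
      congr 2; omega
    rw [assemble_of_isGroupRoot hf hr hap, div_div, ← pow_succ]
    congr 2; omega

/-- The assembled tree does not depend on the values of the pruned nodes. -/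
lemma assemble_congr (hf : 2 ≤ f) {P : Grouping n f}
    {y y' : (k : Fin (height n f)) → Fin (levelSize n f k) → EReal}
    (h : ∀ v : Node n f, ¬ IsPruned P v → y v.1 v.2 = y' v.1 v.2) :
    assemble P y = assemble P y' := by
  funext k j
  by_cases hp : IsPruned P ⟨k, j⟩
  · obtain ⟨r, hr, ha⟩ := hp
    rw [assemble_of_isGroupRoot (v := ⟨k, j⟩) hf hr ha,
      assemble_of_isGroupRoot (v := ⟨k, j⟩) hf hr ha,
      h r (hr.not_isPruned hf)]
  · rw [assemble_of_not_isPruned (v := ⟨k, j⟩) hp, assemble_of_not_isPruned (v := ⟨k, j⟩) hp,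
      h _ hp]

/-! ### The grouping of a set of flags -/

/-- The nodes that may become group roots: the full nodes that carry the flag `φ`. A leaf always
counts as flagged. -/
def Flag (n f : ℕ) (φ : ℕ → ℕ → Prop) (k j : ℕ) : Prop := FullAt n f k j ∧ (k = 0 ∨ φ k j)

open Classical in
/-- The level of the topmost flagged node above bin `i`. -/
def topLevel (n f : ℕ) (φ : ℕ → ℕ → Prop) (i : Fin n) : ℕ :=
  Nat.findGreatest (fun k => Flag n f φ k ((i : ℕ) / f ^ k)) (height n f)

lemma flag_topLevel (hf : 2 ≤ f) (φ : ℕ → ℕ → Prop) (i : Fin n) :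
    Flag n f φ (topLevel n f φ i) ((i : ℕ) / f ^ topLevel n f φ i) := by
  classical
  refine Nat.findGreatest_spec (P := fun k => Flag n f φ k ((i : ℕ) / f ^ k)) (Nat.zero_le _) ?_
  exact ⟨fullAt_zero hf (by simp), Or.inl rfl⟩

lemma le_topLevel (hf : 2 ≤ f) {φ : ℕ → ℕ → Prop} {i : Fin n} {k : ℕ}
    (h : Flag n f φ k ((i : ℕ) / f ^ k)) : k ≤ topLevel n f φ i := by
  classical
  exact Nat.le_findGreatest (h.1.lt_height hf).le h

lemma topLevel_eq_of_mem (hf : 2 ≤ f) {φ : ℕ → ℕ → Prop} {i i' : Fin n}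
    (h : i' ∈ leavesAt n f (topLevel n f φ i) ((i : ℕ) / f ^ topLevel n f φ i)) :
    topLevel n f φ i' = topLevel n f φ i := by
  rw [mem_leavesAt] at h
  have h1 : topLevel n f φ i ≤ topLevel n f φ i' :=
    le_topLevel hf (by rw [h]; exact flag_topLevel hf φ i)
  refine le_antisymm (le_topLevel hf ?_) h1
  have := flag_topLevel hf φ i'
  rwa [div_pow_of_le h1, h, ← div_pow_of_le h1] at this

open Classical in
/-- The grouping whose group roots are the topmost flagged nodes. -/
def groupingOf (hf : 2 ≤ f) (φ : ℕ → ℕ → Prop) : Grouping n f :=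
  ⟨Finpartition.ofSetoid (Setoid.ker fun i : Fin n =>
      leavesAt n f (topLevel n f φ i) ((i : ℕ) / f ^ topLevel n f φ i)), by
    intro g hg
    obtain ⟨i, hi⟩ := (Finpartition.ofSetoid _).nonempty_of_mem_parts hg
    refine ⟨⟨⟨topLevel n f φ i, (flag_topLevel hf φ i).1.lt_height hf⟩,
      ⟨(i : ℕ) / f ^ topLevel n f φ i, div_lt_levelSize hf _ i.2⟩⟩, (flag_topLevel hf φ i).1, ?_⟩
    rw [← Finpartition.part_eq_of_mem _ hg hi]
    ext i'
    rw [Finpartition.mem_part_ofSetoid_iff_rel, Setoid.ker_def, leaves_eq_leavesAt]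
    constructor
    · intro h
      rw [topLevel_eq_of_mem hf h, mem_leavesAt.1 h]
    · intro h
      rw [h, mem_leavesAt]⟩

lemma part_groupingOf (hf : 2 ≤ f) (φ : ℕ → ℕ → Prop) (i : Fin n) :
    (groupingOf hf φ : Grouping n f).1.part i =
      leavesAt n f (topLevel n f φ i) ((i : ℕ) / f ^ topLevel n f φ i) := by
  classical
  ext i'
  unfold groupingOf
  rw [Finpartition.mem_part_ofSetoid_iff_rel, Setoid.ker_def]
  constructor
  · intro h
    rw [h, mem_leavesAt]
  · intro h
    rw [topLevel_eq_of_mem hf h, mem_leavesAt.1 h]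

lemma isPruned_groupingOf (hf : 2 ≤ f) (φ : ℕ → ℕ → Prop) (v : Node n f) :
    IsPruned (groupingOf hf φ) v ↔
      ∃ k > (v.1 : ℕ), Flag n f φ k ((v.2 : ℕ) / f ^ (k - (v.1 : ℕ))) := by
  obtain ⟨i, hi⟩ := exists_mem_leaves hf v
  have hi' := mem_leavesAt.1 hi
  constructor
  · rintro ⟨r, hr, ha⟩
    have hir := ha.leaves_subset hi
    have hp := (groupingOf hf φ : Grouping n f).1.part_eq_of_mem hr.2 hir
    rw [part_groupingOf] at hp
    obtain ⟨h1, h2⟩ := FullAt.eq_of_leavesAt_eq hf (flag_topLevel hf φ i).1 hr.1 hp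
    refine ⟨r.1, ha.1, ?_⟩
    have := flag_topLevel hf φ i
    rw [h2, h1] at this
    rwa [ha.2]
  · rintro ⟨k, hk, hfl⟩
    rw [← hi', ← div_pow_of_le hk.le] at hfl
    have hle := le_topLevel hf hfl
    refine ⟨⟨⟨topLevel n f φ i, (flag_topLevel hf φ i).1.lt_height hf⟩,
      ⟨(i : ℕ) / f ^ topLevel n f φ i, div_lt_levelSize hf _ i.2⟩⟩,
      ⟨(flag_topLevel hf φ i).1, ?_⟩, by simp only; omega, ?_⟩
    · rw [leaves_eq_leavesAt]
      simp only
      rw [← part_groupingOf hf φ i]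
      exact (groupingOf hf φ : Grouping n f).1.part_mem.2 (Finset.mem_univ i)
    · simp only
      rw [← hi', ← div_pow_of_le (by omega)]

lemma isPruned_iff_parent (hf : 2 ≤ f) (φ : ℕ → ℕ → Prop) {v p : Node n f}
    (h1 : (p.1 : ℕ) = v.1 + 1) (h2 : (p.2 : ℕ) = v.2 / f) :
    IsPruned (groupingOf hf φ) v ↔ Flag n f φ p.1 p.2 ∨ IsPruned (groupingOf hf φ) p := by
  rw [isPruned_groupingOf, isPruned_groupingOf]
  have key : ∀ k > (p.1 : ℕ),
      (v.2 : ℕ) / f ^ (k - (v.1 : ℕ)) = (p.2 : ℕ) / f ^ (k - (p.1 : ℕ)) := by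
    intro k hk
    rw [h2, Nat.div_div_eq_div_mul, ← pow_succ']
    congr 2; omega
  constructor
  · rintro ⟨k, hk, h⟩
    rcases (show (p.1 : ℕ) ≤ k by omega).eq_or_lt with he | hlt
    · left
      rw [← he, h1, Nat.add_sub_cancel_left, pow_one, ← h2, ← h1] at h
      exact h
    · exact Or.inr ⟨k, hlt, by rwa [← key k hlt]⟩
  · rintro (h | ⟨k, hk, h⟩)
    · refine ⟨p.1, by omega, ?_⟩
      rw [h1, Nat.add_sub_cancel_left, pow_one, ← h2, ← h1]
      exact h
    · exact ⟨k, by omega, by rwa [key k hk]⟩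

lemma groupingOf_congr (hf : 2 ≤ f) {φ ψ : ℕ → ℕ → Prop}
    (h : ∀ k < height n f, ∀ j < n, φ k j ↔ ψ k j) :
    (groupingOf hf φ : Grouping n f) = groupingOf hf ψ := by
  have hfl : Flag n f φ = Flag n f ψ := by
    funext k j
    simp only [Flag, eq_iff_iff]
    refine and_congr_right fun hF => ?_
    have h1 := hF.lt_levelSize hf
    have h2 : j < n := lt_of_le_of_lt (Nat.le_mul_of_pos_right j (by positivity))
      ((lt_levelSize hf).1 h1)
    rw [h k (hF.lt_height hf) j h2]
  have ht : topLevel n f φ = topLevel n f ψ := by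
    funext i; unfold topLevel; congr 1; rw [hfl]
  classical
  refine Subtype.ext ?_
  change Finpartition.ofSetoid _ = Finpartition.ofSetoid _
  simp only [ht]

/-! ### Optimality -/

/-- The share of bin `i` in the cost of its group. -/
def share (c : Finset (Fin n) → ℝ) (P : Grouping n f) (i : Fin n) : ℝ :=
  c (P.1.part i) / (P.1.part i).card

lemma sum_share_of_mem (c : Finset (Fin n) → ℝ) (P : Grouping n f) {g : Finset (Fin n)}
    (hg : g ∈ P.1.parts) : ∑ i ∈ g, share c P i = c g := by
  have h0 : (g.card : ℝ) ≠ 0 := by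
    exact_mod_cast (Finset.card_pos.2 (P.1.nonempty_of_mem_parts hg)).ne'
  rw [Finset.sum_congr rfl fun i hi => by rw [share, P.1.part_eq_of_mem hg hi], Finset.sum_const,
    nsmul_eq_mul, mul_div_cancel₀ _ h0]

lemma sum_share (c : Finset (Fin n) → ℝ) (P : Grouping n f) :
    ∑ i, share c P i = ∑ g ∈ P.1.parts, c g := by
  rw [← Finset.sum_congr rfl fun g hg => sum_share_of_mem c P hg]
  exact (Finset.sum_congr P.1.biUnion_parts.symm fun _ _ => rfl).trans
    (Finset.sum_biUnion P.1.disjoint)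

open Classical in
/-- The sum of the optimal costs of the children of a node; a leaf gets its own cost. -/
def kidsCost (n f : ℕ) (c : ℕ → ℕ → ℝ) : ℕ → ℕ → ℝ
  | 0, j => c 0 j
  | k + 1, q => ∑ j ∈ (Finset.range (levelSize n f k)).filter (fun j => j / f = q),
      if FullAt n f k j ∧ c k j ≤ kidsCost n f c k j then c k j else kidsCost n f c k j

/-- It does not cost more to make the leaves of the node a single group. -/
def Cheap (n f : ℕ) (c : ℕ → ℕ → ℝ) (k j : ℕ) : Prop := c k j ≤ kidsCost n f c k j

open Classical in
/-- The optimal cost of a node. -/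
def bestCost (n f : ℕ) (c : ℕ → ℕ → ℝ) (k j : ℕ) : ℝ :=
  if FullAt n f k j ∧ c k j ≤ kidsCost n f c k j then c k j else kidsCost n f c k j

lemma kidsCost_succ (c : ℕ → ℕ → ℝ) (k q : ℕ) : kidsCost n f c (k + 1) q =
    ∑ j ∈ (Finset.range (levelSize n f k)).filter (fun j => j / f = q), bestCost n f c k j := rfl

lemma flag_cheap {c : ℕ → ℕ → ℝ} {k j : ℕ} :
    Flag n f (Cheap n f c) k j ↔ FullAt n f k j ∧ c k j ≤ kidsCost n f c k j := by
  refine and_congr_right fun _ => or_iff_right_of_imp ?_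
  rintro rfl
  exact le_rfl

lemma bestCost_le_kidsCost (c : ℕ → ℕ → ℝ) (k j : ℕ) :
    bestCost n f c k j ≤ kidsCost n f c k j := by
  unfold bestCost; split_ifs with h
  exacts [h.2, le_rfl]

lemma bestCost_le_of_fullAt (c : ℕ → ℕ → ℝ) {k j : ℕ} (h : FullAt n f k j) :
    bestCost n f c k j ≤ c k j := by
  unfold bestCost; split_ifs with h'
  · exact le_rfl
  · exact (not_le.1 fun h2 => h' ⟨h, h2⟩).le

/-- No grouping beats the optimal cost of a node on the bins below that node. -/
lemma bestCost_le_sum_share (hf : 2 ≤ f) (c : Finset (Fin n) → ℝ) (P : Grouping n f) :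
    ∀ k j, j < levelSize n f k →
      (∀ i ∈ leavesAt n f k j, P.1.part i ⊆ leavesAt n f k j) →
      bestCost n f (fun k j => c (leavesAt n f k j)) k j ≤
        ∑ i ∈ leavesAt n f k j, share c P i := by
  intro k
  induction k with
  | zero =>
    intro j hj hsub
    obtain ⟨i, hi⟩ := exists_mem_leavesAt hf hj
    obtain ⟨x, hx⟩ := Finset.card_eq_one.1
      (fullAt_zero hf (by rwa [levelSize_zero] at hj) : FullAt n f 0 j)
    rw [hx, Finset.mem_singleton] at hi
    subst hi
    have hpart : P.1.part i = leavesAt n f 0 j := by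
      refine Finset.Subset.antisymm (hsub i (by simp [hx])) ?_
      rw [hx, Finset.singleton_subset_iff]
      exact P.1.mem_part (Finset.mem_univ i)
    refine (bestCost_le_kidsCost _ _ _).trans ?_
    rw [kidsCost, ← hpart, sum_share_of_mem c P (P.1.part_mem.2 (Finset.mem_univ i))]
  | succ k ih =>
    intro q hq hsub
    by_cases hg : FullAt n f (k + 1) q ∧ leavesAt n f (k + 1) q ∈ P.1.parts
    · rw [sum_share_of_mem c P hg.2]
      exact bestCost_le_of_fullAt _ hg.1
    · refine (bestCost_le_kidsCost _ _ _).trans ?_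
      rw [sum_leavesAt_succ hf, kidsCost_succ]
      refine Finset.sum_le_sum fun j hj => ?_
      simp only [Finset.mem_filter, Finset.mem_range] at hj
      refine ih j hj.1 fun i hi => ?_
      rw [mem_leavesAt] at hi
      have hiq : i ∈ leavesAt n f (k + 1) q := by rw [mem_leavesAt, div_pow_succ, hi, hj.2]
      obtain ⟨K, _, hK, hpart⟩ := P.exists_part_eq i
      -- a group that is not below a child fills the whole subtree
      rcases le_or_gt K k with hKk | hKk
      · rw [hpart, ← hi, div_pow_of_le hKk]
        exact leavesAt_subset hKk _
      · exfalso
        have hsup : leavesAt n f (k + 1) q ⊆ P.1.part i := by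
          rw [hpart, div_pow_of_le hKk, mem_leavesAt.1 hiq]
          exact leavesAt_subset hKk q
        have heq : P.1.part i = leavesAt n f (k + 1) q := Finset.Subset.antisymm (hsub i hiq) hsup
        have hcard : f ^ K ≤ f ^ (k + 1) := by
          rw [← hK, ← hpart, heq]; exact card_leavesAt_le hf _ _
        rw [Nat.pow_le_pow_iff_right (by omega)] at hcard
        obtain rfl : K = k + 1 := by omega
        rw [mem_leavesAt.1 hiq] at hK
        exact hg ⟨hK, heq ▸ P.1.part_mem.2 (Finset.mem_univ i)⟩

/-- The topmost cheap nodes attain the optimal costs. -/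
lemma sum_share_groupingOf (hf : 2 ≤ f) (c : Finset (Fin n) → ℝ) :
    ∀ k j, j < levelSize n f k →
      (∀ k' > k, ¬ Flag n f (Cheap n f fun k j => c (leavesAt n f k j)) k' (j / f ^ (k' - k))) →
      ∑ i ∈ leavesAt n f k j,
          share c (groupingOf hf (Cheap n f fun k j => c (leavesAt n f k j))) i =
        bestCost n f (fun k j => c (leavesAt n f k j)) k j := by
  set C := fun k j => c (leavesAt n f k j) with hC
  -- a flagged node without flagged nodes above it is a group root
  have root : ∀ k j, Flag n f (Cheap n f C) k j →
      (∀ k' > k, ¬ Flag n f (Cheap n f C) k' (j / f ^ (k' - k))) →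
      ∑ i ∈ leavesAt n f k j, share c (groupingOf hf (Cheap n f C)) i = bestCost n f C k j := by
    intro k j hfl hno
    obtain ⟨i, hi⟩ := hfl.1.nonempty hf
    have hi' := mem_leavesAt.1 hi
    have htop : topLevel n f (Cheap n f C) i = k := by
      refine le_antisymm (not_lt.1 fun hlt => hno _ hlt ?_) (le_topLevel hf (by rwa [hi']))
      have := flag_topLevel hf (Cheap n f C) i
      rwa [div_pow_of_le hlt.le, hi'] at this
    have hpart := part_groupingOf hf (Cheap n f C) i
    rw [htop, hi'] at hpart
    rw [← hpart, sum_share_of_mem _ _ ((groupingOf hf _).1.part_mem.2 (Finset.mem_univ i)), hpart,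
      bestCost, if_pos (flag_cheap.1 hfl)]
  intro k
  induction k with
  | zero =>
    intro j hj hno
    rw [levelSize_zero] at hj
    exact root 0 j ⟨fullAt_zero hf hj, Or.inl rfl⟩ hno
  | succ k ih =>
    intro q hq hno
    by_cases hfl : Flag n f (Cheap n f C) (k + 1) q
    · exact root _ _ hfl hno
    · rw [bestCost, if_neg (by rwa [flag_cheap] at hfl), sum_leavesAt_succ hf, kidsCost_succ]
      refine Finset.sum_congr rfl fun j hj => ?_
      simp only [Finset.mem_filter, Finset.mem_range] at hj
      refine ih j hj.1 fun k' hk' hfl' => ?_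
      rcases (Nat.succ_le_of_lt hk').eq_or_lt with he | hlt
      · subst he
        rw [show k.succ - k = 1 by omega, pow_one, hj.2] at hfl'
        exact hfl hfl'
      · refine hno k' hlt ?_
        rw [← hj.2, Nat.div_div_eq_div_mul, ← pow_succ']
        convert hfl' using 3
        omega

lemma leavesAt_root (hf : 2 ≤ f) : leavesAt n f (height n f - 1) 0 = Finset.univ := by
  ext i
  simp only [mem_leavesAt, Finset.mem_univ, iff_true]
  exact Nat.div_eq_of_lt (i.2.trans_le (Nat.le_pow_clog (by omega) n))

/-- Grouping below the topmost cheap nodes minimizes the sum of the costs of the groups. -/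
lemma sum_cost_groupingOf_le (hn : 0 < n) (hf : 2 ≤ f) (c : Finset (Fin n) → ℝ)
    (P : Grouping n f) :
    ∑ g ∈ (groupingOf hf (Cheap n f fun k j => c (leavesAt n f k j)) : Grouping n f).1.parts, c g ≤
      ∑ g ∈ P.1.parts, c g := by
  rw [← sum_share, ← sum_share, ← leavesAt_root (n := n) hf]
  rw [sum_share_groupingOf hf c _ 0 (levelSize_pos hn hf _)]
  · refine bestCost_le_sum_share hf c P _ 0 (levelSize_pos hn hf _) fun i _ => ?_
    rw [leavesAt_root hf]
    exact Finset.subset_univ _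
  · intro k hk h
    have := h.1.lt_height hf
    omega

/-! ### The optimal selection -/

/-- The selection rule of the program: the groups are the leaf sets of the topmost full nodes that
are not more expensive than the optimal groupings of their children. -/
def optSel (hf : 2 ≤ f) (ε : ℝ) (debias : Bool) (b : Fin n → ℝ) : Grouping n f :=
  groupingOf hf (Cheap n f fun k j => groupCost f ε debias b (leavesAt n f k j))

lemma measurable_groupCost (ε : ℝ) (debias : Bool) (g : Finset (Fin n)) :
    Measurable (fun b => groupCost f ε debias b g) := by
  unfold groupCost groupAvg
  fun_prop

lemma measurable_kidsCost (ε : ℝ) (debias : Bool) : ∀ k j, Measurable fun b : Fin n → ℝ =>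
    kidsCost n f (fun k j => groupCost f ε debias b (leavesAt n f k j)) k j := by
  classical
  intro k
  induction k with
  | zero => exact fun j => measurable_groupCost ε debias _
  | succ k ih =>
    intro q
    simp only [kidsCost]
    refine Finset.measurable_fun_sum _ fun j _ => ?_
    refine Measurable.ite ?_ (measurable_groupCost ε debias _) (ih j)
    by_cases hF : FullAt n f k j
    · simpa only [hF, true_and] using
        measurableSet_le (measurable_groupCost ε debias (leavesAt n f k j)) (ih j)
    · simp [hF]

lemma measurable_optSel (hf : 2 ≤ f) (ε : ℝ) (debias : Bool) :
    Measurable (optSel (n := n) hf ε debias) := by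
  let Φ : (Fin n → ℝ) → (Fin (height n f) × Fin n → Prop) := fun b v =>
    Cheap n f (fun k j => groupCost f ε debias b (leavesAt n f k j)) v.1 v.2
  let G : (Fin (height n f) × Fin n → Prop) → Grouping n f := fun ψ =>
    groupingOf hf fun k j => ∃ (hk : k < height n f) (hj : j < n), ψ (⟨k, hk⟩, ⟨j, hj⟩)
  have hΦ : Measurable Φ := measurable_pi_iff.2 fun v => measurableSet_setOfPred.1
    (measurableSet_le (measurable_groupCost ε debias _) (measurable_kidsCost ε debias _ _))
  have hG : Measurable G := Measurable.of_discrete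
  have : optSel (n := n) hf ε debias = G ∘ Φ := by
    funext b
    refine groupingOf_congr hf fun k hk j hj => ?_
    simp [Φ, hk, hj]
  rw [this]
  exact hG.comp hΦ

lemma isOptimalSelection_optSel (hn : 0 < n) (hf : 2 ≤ f) (ε : ℝ) (debias : Bool) :
    IsOptimalSelection ε debias (optSel (n := n) hf ε debias) :=
  ⟨measurable_optSel hf ε debias, fun _ P => sum_cost_groupingOf_le hn hf _ P⟩

end Groupings

/-! ### Execution of programs -/

open Classical in
/-- The effect of a loop-free program; loops are skipped. -/
def exec (ω : ℕ → ℝ) : Prog → State → State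
  | .setInt a i x, s => s.setInt a (i.eval s) (x.eval s)
  | .setReal a i x, s => s.setReal a (i.eval s) (x.eval s)
  | .draw a i x, s =>
      { s.setReal a (i.eval s) (x.eval s * ω s.draws) with draws := s.draws + 1 }
  | .seq p q, s => exec ω q (exec ω p s)
  | .ite c p q, s => if c.eval s then exec ω p s else exec ω q s
  | .loop _ _, s => s

/-- A bound for the running time of a loop-free program. -/
def maxCost : Prog → ℕ
  | .setInt _ i x => i.cost + x.cost + 1
  | .setReal _ i x => i.cost + x.cost + 1
  | .draw _ i x => i.cost + x.cost + 1
  | .seq p q => maxCost p + maxCost q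
  | .ite c p q => c.cost + (maxCost p + maxCost q) + 1
  | .loop _ _ => 0

/-- The program contains no loop. -/
def LoopFree : Prog → Prop
  | .seq p q => LoopFree p ∧ LoopFree q
  | .ite _ p q => LoopFree p ∧ LoopFree q
  | .loop _ _ => False
  | _ => True

lemma runs_exec (ω : ℕ → ℝ) (p : Prog) (hp : LoopFree p) (s : State) :
    ∃ T, Runs ω p s (exec ω p s) T ∧ T ≤ maxCost p := by
  induction p generalizing s with
  | setInt a i x => exact ⟨_, .setInt a i x s, le_rfl⟩
  | setReal a i x => exact ⟨_, .setReal a i x s, le_rfl⟩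
  | draw a i x => exact ⟨_, .draw a i x s, le_rfl⟩
  | seq p q ihp ihq =>
    obtain ⟨T, h, hT⟩ := ihp hp.1 s
    obtain ⟨T', h', hT'⟩ := ihq hp.2 (exec ω p s)
    exact ⟨_, .seq h h', add_le_add hT hT'⟩
  | ite c p q ihp ihq =>
    rw [exec, maxCost]
    split_ifs with hc
    · obtain ⟨T, h, hT⟩ := ihp hp.1 s
      exact ⟨_, .iteTrue hc h, by omega⟩
    · obtain ⟨T, h, hT⟩ := ihq hp.2 s
      exact ⟨_, .iteFalse hc h, by omega⟩
  | loop c p => exact hp.elim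

/-- A bound for the running time of one iteration of a loop. -/
def loopCost : Prog → ℕ
  | .loop c p => c.cost + maxCost p + 1
  | _ => 0

/-- Started in `s`, the program halts within `B` steps in a state with property `Q`. -/
def Ends (ω : ℕ → ℝ) (p : Prog) (s : State) (B : ℕ) (Q : State → Prop) : Prop :=
  ∃ s' T, Runs ω p s s' T ∧ T ≤ B ∧ Q s'

lemma Ends.of_exec {ω : ℕ → ℝ} {p : Prog} (hp : LoopFree p) {s : State} {Q : State → Prop}
    (h : Q (exec ω p s)) : Ends ω p s (maxCost p) Q := by
  obtain ⟨T, hr, hT⟩ := runs_exec ω p hp s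
  exact ⟨_, T, hr, hT, h⟩

lemma Ends.seq {ω : ℕ → ℝ} {p q : Prog} {s : State} {B B' : ℕ} {Q Q' : State → Prop}
    (hp : Ends ω p s B Q) (hq : ∀ s', Q s' → Ends ω q s' B' Q') :
    Ends ω (.seq p q) s (B + B') Q' := by
  obtain ⟨s', T, hr, hT, h⟩ := hp
  obtain ⟨s'', T', hr', hT', h'⟩ := hq s' h
  exact ⟨s'', _, .seq hr hr', add_le_add hT hT', h'⟩

/-- A loop with an invariant that determines the number `m` of iterations. -/
lemma Ends.loop {ω : ℕ → ℝ} {c : Test} {p : Prog} (hp : LoopFree p) {Inv : ℕ → State → Prop}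
    {m : ℕ} (step : ∀ i < m, ∀ s, Inv i s → c.eval s ∧ Inv (i + 1) (exec ω p s))
    (final : ∀ s, Inv m s → ¬ c.eval s) {s : State} (h : Inv 0 s) :
    Ends ω (.loop c p) s ((m + 1) * loopCost (.loop c p)) (Inv m) := by
  have key : ∀ d i s, i + d = m → Inv i s →
      Ends ω (.loop c p) s ((d + 1) * (c.cost + maxCost p + 1)) (Inv m) := by
    intro d
    induction d with
    | zero =>
      intro i s hi hs
      obtain rfl : i = m := hi
      exact ⟨s, _, .loopDone (final s hs), by omega, hs⟩
    | succ d ih =>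
      intro i s hi hs
      obtain ⟨hc, hs'⟩ := step i (by omega) s hs
      obtain ⟨T, hr, hT⟩ := runs_exec ω p hp s
      obtain ⟨s'', T', hr', hT', h'⟩ := ih (i + 1) _ (by omega) hs'
      refine ⟨s'', _, .loopStep hc hr hr', ?_, h'⟩
      rw [add_mul (d + 1) 1]
      omega
  exact key m 0 s (by omega) h

section State

variable (s : State) (a a' i v : ℕ) (x : ℝ)

@[simp] lemma setInt_reals : (s.setInt a i v).reals = s.reals := rfl
@[simp] lemma setInt_draws : (s.setInt a i v).draws = s.draws := rfl
@[simp] lemma setReal_ints : (s.setReal a i x).ints = s.ints := rfl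
@[simp] lemma setReal_draws : (s.setReal a i x).draws = s.draws := rfl

@[simp] lemma setInt_ints : (s.setInt a i v).ints a' =
    if a' = a then Function.update (s.ints a) i v else s.ints a' := by
  simp only [State.setInt, Function.update_apply]

@[simp] lemma setReal_reals : (s.setReal a i x).reals a' =
    if a' = a then Function.update (s.reals a) i x else s.reals a' := by
  simp only [State.setReal, Function.update_apply]

end State

attribute [simp] exec NExpr.eval RExpr.eval Test.eval

/-! ### Numbering of the nodes -/

section Offset

variable {n f : ℕ}

/-- The number of nodes below level `k`. -/
def offset (n f k : ℕ) : ℕ := ∑ k' ∈ Finset.range k, levelSize n f k'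

lemma offset_zero : offset n f 0 = 0 := rfl

lemma offset_succ (k : ℕ) : offset n f (k + 1) = offset n f k + levelSize n f k :=
  Finset.sum_range_succ _ _

lemma offset_mono {k l : ℕ} (h : k ≤ l) : offset n f k ≤ offset n f l :=
  Finset.sum_le_sum_of_subset (Finset.range_mono h)

lemma offset_add_lt {k l j : ℕ} (h : k < l) (hj : j < levelSize n f k) :
    offset n f k + j < offset n f l := by
  have := offset_mono (n := n) (f := f) (Nat.succ_le_of_lt h)
  rw [Nat.succ_eq_add_one, offset_succ] at this
  omega

lemma offset_inj {k j k' j' : ℕ} (hj : j < levelSize n f k) (hj' : j' < levelSize n f k')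
    (h : offset n f k + j = offset n f k' + j') : k = k' ∧ j = j' := by
  rcases lt_trichotomy k k' with hk | rfl | hk
  · have := offset_add_lt hk hj; omega
  · exact ⟨rfl, by omega⟩
  · have := offset_add_lt hk hj'; omega

/-- The tree has at most `3 * n` nodes, since the sizes of the levels drop geometrically. -/
lemma offset_height_le (hn : 0 < n) (hf : 2 ≤ f) : offset n f (height n f) ≤ 3 * n := by
  have key : ∀ k, offset n f k + 2 * levelSize n f k ≤ 2 * n + k := by
    intro k
    induction k with
    | zero => simp [offset_zero, levelSize_zero]
    | succ k ih =>
      have h1 : (levelSize n f k - 1) / f ≤ (levelSize n f k - 1) / 2 :=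
        Nat.div_le_div_left hf (by norm_num)
      have := levelSize_pos hn hf k
      rw [offset_succ, levelSize_succ hn hf]
      omega
  have h1 := key (height n f)
  have h2 : Nat.clog f n ≤ n :=
    (Nat.clog_le_iff_le_pow (by omega)).2 (Nat.lt_pow_self (by omega)).le
  have h3 := levelSize_pos hn hf (height n f)
  unfold height at *
  omega

/-- The state of an array in which every node accumulates the values `V` of its children, when the
nodes before node `J` of level `K` have been processed: the remaining nodes of level `K` hold their
final values `A`, and those of the next level the contributions of the processed children. -/
def Acc {M : Type*} [AddCommMonoid M] (n f : ℕ) (A V : ℕ → ℕ → M) (K J : ℕ) (arr : ℕ → M) : Prop :=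
  (∀ j, J ≤ j → j < levelSize n f K → arr (offset n f K + j) = A K j) ∧
    ∀ q, arr (offset n f (K + 1) + q) = ∑ j ∈ (Finset.range J).filter (fun j => j / f = q), V K j

variable {M : Type*} [AddCommMonoid M] {A V : ℕ → ℕ → M} {K J : ℕ} {arr : ℕ → M}

lemma Acc.value (h : Acc n f A V K J arr) (hJ : J < levelSize n f K) :
    arr (offset n f K + J) = A K J := h.1 J le_rfl hJ

lemma Acc.succ (h : Acc n f A V K J arr) {x : M} (hx : x = V K J) :
    Acc n f A V K (J + 1) (Function.update arr (offset n f (K + 1) + J / f)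
      (arr (offset n f (K + 1) + J / f) + x)) := by
  subst hx
  constructor
  · intro j hj hj'
    have := offset_succ (n := n) (f := f) K
    rw [Function.update_of_ne (by generalize J / f = d; omega)]
    exact h.1 j (by omega) hj'
  · intro q
    rw [Finset.range_add_one, Finset.filter_insert]
    by_cases hq : J / f = q
    · rw [if_pos hq, Finset.sum_insert (by simp), ← hq, Function.update_self, h.2, add_comm]
    · rw [if_neg hq, Function.update_of_ne (by omega), h.2]

lemma Acc.next (hf : 2 ≤ f) (hA : ∀ k q, A (k + 1) q =
      ∑ j ∈ (Finset.range (levelSize n f k)).filter (fun j => j / f = q), V k j)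
    (h : Acc n f A V K (levelSize n f K) arr) : Acc n f A V (K + 1) 0 arr := by
  constructor
  · intro j _ _
    rw [h.2, hA]
  · intro q
    rw [offset_succ (K + 1), add_assoc, h.2]
    refine Eq.trans (Finset.sum_eq_zero fun j hj => ?_) (by simp)
    simp only [Finset.mem_filter, Finset.mem_range] at hj
    have := div_lt_levelSize_succ hf hj.1
    omega

end Offset

/-! ### The program -/

/-- The scalar variable in cell `0` of an integer array. -/
abbrev var (a : ℕ) : NExpr := .load a (.const 0)

/-- The scalar variable in cell `0` of a real array. -/
abbrev rvar (a : ℕ) : RExpr := .load a (.const 0)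

/-- A natural number as a real expression. -/
abbrev rconst (c : ℕ) : RExpr := .cast (.const c)

/-- The value `4 * t / (3 * ε)` of `groupError`. -/
def groupErrorExpr : RExpr :=
  .div (.mul (rconst 4) (.cast (var 2))) (.mul (rconst 3) (rvar 0))

/-- The value `ε / 4` of `groupingBudget`. -/
def groupingBudgetExpr : RExpr := .div (rvar 0) (rconst 4)

/-- The value `3 * ε / 4 / t` of `levelBudget`. -/
def levelBudgetExpr : RExpr := .div (.div (.mul (rconst 3) (rvar 0)) (rconst 4)) (.cast (var 2))

/-- Computes the height of the tree. -/
def heightLoop : Prog :=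
  .loop (.natLe (.add (var 7) (.const 1)) (var 0))
    (.seq (.setInt 7 (.const 0) (.mul (var 7) (var 1)))
      (.setInt 2 (.const 0) (.add (var 2) (.const 1))))

/-- Draws the noise of the bins, and initializes the accumulators of the leaves. -/
def binLoop : Prog :=
  .loop (.natLe (.add (var 8) (.const 1)) (var 0))
    (.seq (.draw 4 (var 8) (.div (rconst 1) groupingBudgetExpr))
    (.seq (.setReal 4 (var 8) (.add (.load 2 (var 8)) (.load 4 (var 8))))
    (.seq (.setReal 5 (var 8) (.mul (.load 4 (var 8)) (.load 4 (var 8))))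
    (.seq (.setReal 6 (var 8) (.mul groupErrorExpr groupErrorExpr))
    (.seq (.setInt 12 (var 8) (.const 1))
      (.setInt 8 (.const 0) (.add (var 8) (.const 1))))))))

/-- The cost of the leaves of the current node as a single group. -/
def groupCostExpr (debias : Bool) : RExpr :=
  .sub (.add (.sub (.load 5 (var 8))
      (.div (.mul (.load 4 (var 8)) (.load 4 (var 8))) (.cast (.load 12 (var 8)))))
    (.mul groupErrorExpr groupErrorExpr))
    (if debias then .div (.mul (rconst 2) (.sub (.cast (.load 12 (var 8))) (rconst 1)))
      (.mul groupingBudgetExpr groupingBudgetExpr) else rconst 0)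

/-- The current node is full, and its own cost (in `rvar 7`) is at most the cost of its children. -/
def flagTest : Test :=
  .conj (.conj (.natLe (.load 12 (var 8)) (var 7)) (.natLe (var 7) (.load 12 (var 8))))
    (.realLe (rvar 7) (.load 6 (var 8)))

/-- Determines the parent, the flag and the optimal cost of the current node. -/
def flagProg (debias : Bool) : Prog :=
  .seq (.setInt 10 (var 8) (.add (var 9) (var 5)))
  (.seq (.setReal 7 (.const 0) (groupCostExpr debias))
    (.ite flagTest (.setInt 11 (var 8) (.const 1)) (.setReal 7 (.const 0) (.load 6 (var 8)))))

/-- Draws the noise of the current node, and adds the accumulated values to those of the parent. -/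
def pushProg : Prog :=
  .seq (.draw 3 (var 8) (.div (rconst 1) (.mul (.load 1 (var 3)) levelBudgetExpr)))
  (.seq (.setReal 3 (var 8) (.add (.load 2 (var 8)) (.load 3 (var 8))))
  (.seq (.setInt 12 (.load 10 (var 8)) (.add (.load 12 (.load 10 (var 8))) (.load 12 (var 8))))
  (.seq (.setReal 2 (.load 10 (var 8)) (.add (.load 2 (.load 10 (var 8))) (.load 2 (var 8))))
  (.seq (.setReal 4 (.load 10 (var 8)) (.add (.load 4 (.load 10 (var 8))) (.load 4 (var 8))))
  (.seq (.setReal 5 (.load 10 (var 8)) (.add (.load 5 (.load 10 (var 8))) (.load 5 (var 8))))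
    (.setReal 6 (.load 10 (var 8)) (.add (.load 6 (.load 10 (var 8))) (rvar 7))))))))

/-- Proceeds to the next node of the level, or to the first node of the next level. -/
def advanceProg : Prog :=
  .seq (.setInt 8 (.const 0) (.add (var 8) (.const 1)))
  (.ite (.natLe (.add (var 4) (.const 2)) (var 6))
    (.seq (.setInt 4 (.const 0) (.add (var 4) (.const 1)))
      (.ite (.natLe (.mul (.add (var 5) (.const 1)) (var 1)) (var 4))
        (.setInt 5 (.const 0) (.add (var 5) (.const 1)))
        (.setInt 5 (.const 0) (var 5))))
    (.seq (.setInt 3 (.const 0) (.add (var 3) (.const 1)))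
    (.seq (.setInt 4 (.const 0) (.const 0))
    (.seq (.setInt 6 (.const 0) (.add (var 5) (.const 1)))
    (.seq (.setInt 9 (.const 0) (.add (var 9) (var 6)))
    (.seq (.setInt 5 (.const 0) (.const 0))
      (.setInt 7 (.const 0) (.mul (var 7) (var 1)))))))))

/-- Visits all nodes, the children before their parents. -/
def bottomUpLoop (debias : Bool) : Prog :=
  .loop (.natLe (.add (var 3) (.const 1)) (var 2))
    (.seq (flagProg debias) (.seq pushProg advanceProg))

/-- Visits all nodes, the parents before their children, and prunes the nodes below a flag. -/
def topDownLoop : Prog :=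
  .loop (.natLe (.const 1) (var 8))
    (.seq (.setInt 8 (.const 0) (.sub (var 8) (.const 1)))
      (.ite (.natLe (.const 1) (.load 11 (.load 10 (var 8))))
        (.seq (.setInt 11 (var 8) (.const 1))
          (.setReal 3 (var 8) (.div (.load 3 (.load 10 (var 8))) (.cast (var 1)))))
        (.setInt 8 (.const 0) (var 8))))

/-- Resets the variables between the loops. -/
def resetProg : Prog :=
  .seq (.setInt 7 (.const 0) (.const 1))
  (.seq (.setInt 8 (.const 0) (.const 0))
  (.seq (.setInt 6 (.const 0) (var 0))
    (.setInt 9 (.const 0) (var 0))))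

/-- The Subtree Smoothing scheme. Integer arrays: `2` height, `3` current level, `4` position of the
current node in its level, `5` position of its parent, `6` size of the level, `7` number of leaves
of a full node of the level, `8` number of the current node, `9` number of the first node of the
next level (all of these in cell `0`); and for all nodes: `10` parent, `11` flag, `12` number of
leaves. Real arrays: `7` cost of the current node (in cell `0`); and for all nodes: `2` sum of the
bins, `3` output, `4` sum of the noisy bins, `5` sum of their squares, `6` sum of the optimal costs
of the children. -/
def treeProg (debias : Bool) : Prog :=
  .seq (.seq (.setInt 7 (.const 0) (.const 1)) (.setInt 2 (.const 0) (.const 1)))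
  (.seq heightLoop (.seq resetProg (.seq binLoop (.seq resetProg
    (.seq (bottomUpLoop debias) topDownLoop)))))

/-! ### Correctness of the program -/

section Correctness

variable {n f : ℕ} {ε : ℝ} {α : Fin (height n f) → ℝ} {h : Fin n → ℕ} {ω : ℕ → ℝ} {s : State}

/-- The parameters `α` as an array. -/
def αArray (α : Fin (height n f) → ℝ) (k : ℕ) : ℝ := if hk : k < height n f then α ⟨k, hk⟩ else 0

/-- A vector of bins as an array. -/
def binArray (w : Fin n → ℝ) (i : ℕ) : ℝ := if hi : i < n then w ⟨i, hi⟩ else 0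

/-- The noisy bins that result from the variates `ω`. -/
def noisyBin (ε : ℝ) (h : Fin n → ℕ) (ω : ℕ → ℝ) (i : Fin n) : ℝ :=
  h i + 1 / groupingBudget ε * ω i

/-- The noisy nodes that result from the variates `ω`. -/
def noisyNode (ε : ℝ) (α : Fin (height n f) → ℝ) (h : Fin n → ℕ) (ω : ℕ → ℝ) (k j : ℕ) : ℝ :=
  ∑ i ∈ leavesAt n f k j, (h i : ℝ) +
    1 / (αArray α k * levelBudget n f ε) * ω (n + (offset n f k + j))

/-- The input is in memory. -/
structure HasInput (ε : ℝ) (α : Fin (height n f) → ℝ) (s : State) : Prop where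
  n_eq : s.ints 0 0 = n
  f_eq : s.ints 1 0 = f
  ε_eq : s.reals 0 0 = ε
  α_eq : s.reals 1 = αArray α

/-- The state after `i` iterations of `heightLoop`. -/
structure HeightInv (ε : ℝ) (α : Fin (height n f) → ℝ) (h : Fin n → ℕ) (i : ℕ) (s : State) :
    Prop where
  input : HasInput ε α s
  t_eq : s.ints 2 0 = i + 1
  pow_eq : s.ints 7 0 = f ^ i
  zero_eq : ∀ a, a = 3 ∨ a = 4 ∨ a = 5 ∨ a = 11 ∨ a = 12 → s.ints a = 0
  bins_eq : s.reals 2 = binArray fun i => h i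
  reals_eq : ∀ a, a = 4 ∨ a = 5 ∨ a = 6 → s.reals a = 0
  draws_eq : s.draws = 0

/-- The state after `i` iterations of `binLoop`. -/
structure BinInv (ε : ℝ) (α : Fin (height n f) → ℝ) (h : Fin n → ℕ) (ω : ℕ → ℝ) (i : ℕ)
    (s : State) : Prop where
  input : HasInput ε α s
  t_eq : s.ints 2 0 = height n f
  zero_eq : ∀ a, a = 3 ∨ a = 4 ∨ a = 5 ∨ a = 11 → s.ints a = 0
  bins_eq : s.reals 2 = binArray fun i => h i
  node_eq : s.ints 8 0 = i
  count_eq : s.ints 12 = fun x => if x < i then 1 else 0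
  sum_eq : s.reals 4 = fun x => if x < i then binArray (noisyBin ε h ω) x else 0
  sq_eq : s.reals 5 = fun x => if x < i then binArray (noisyBin ε h ω) x ^ 2 else 0
  cost_eq : s.reals 6 = fun x => if x < i then groupError n f ε ^ 2 else 0
  draws_eq : s.draws = i

lemma eval_groupErrorExpr (hs : HasInput ε α s) (ht : s.ints 2 0 = height n f) :
    groupErrorExpr.eval s = groupError n f ε := by
  simp [groupErrorExpr, groupError, hs.ε_eq, ht]

lemma eval_groupingBudgetExpr (hs : HasInput ε α s) :
    groupingBudgetExpr.eval s = groupingBudget ε := by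
  simp [groupingBudgetExpr, groupingBudget, hs.ε_eq]

lemma eval_levelBudgetExpr (hs : HasInput ε α s) (ht : s.ints 2 0 = height n f) :
    levelBudgetExpr.eval s = levelBudget n f ε := by
  simp [levelBudgetExpr, levelBudget, hs.ε_eq, ht]

lemma HasInput.congr {s' : State} (hs : HasInput ε α s) (h0 : s'.ints 0 = s.ints 0)
    (h1 : s'.ints 1 = s.ints 1) (h2 : s'.reals 0 = s.reals 0) (h3 : s'.reals 1 = s.reals 1) :
    HasInput ε α s' :=
  ⟨by rw [h0, hs.n_eq], by rw [h1, hs.f_eq], by rw [h2, hs.ε_eq], by rw [h3, hs.α_eq]⟩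

lemma heightInv_initState :
    HeightInv ε α h 0 (exec ω (.seq (.setInt 7 (.const 0) (.const 1))
      (.setInt 2 (.const 0) (.const 1))) (initState ε α h)) := by
  refine ⟨⟨?_, ?_, ?_, ?_⟩, ?_, ?_, ?_, ?_, ?_, ?_⟩
  · simp [initState]
  · simp [initState]
  · simp [initState]
  · funext k; simp [initState, αArray]
  · simp
  · simp
  · rintro a (rfl | rfl | rfl | rfl | rfl) <;> funext i <;> simp [initState]
  · funext k; simp [initState, binArray]
  · rintro a (rfl | rfl | rfl) <;> funext i <;> simp [initState]
  · simp [initState]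

lemma ends_heightLoop (hf : 2 ≤ f) (hs : HeightInv ε α h 0 s) :
    Ends ω heightLoop s ((Nat.clog f n + 1) * loopCost heightLoop)
      (HeightInv ε α h (Nat.clog f n)) := by
  refine Ends.loop (by simp [LoopFree]) (fun i hi s hs => ⟨?_, ?_⟩) (fun s hs => ?_) hs
  · have := (Nat.lt_clog_iff_pow_lt (by omega)).1 hi
    simp only [Test.eval, NExpr.eval, hs.pow_eq, hs.input.n_eq]
    omega
  · have hz := hs.zero_eq
    have hr := hs.reals_eq
    refine ⟨hs.input.congr ?_ ?_ ?_ ?_, ?_, ?_, ?_, ?_, ?_, ?_⟩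
    · simp
    · simp
    · simp
    · simp
    · simp [hs.t_eq]
    · simp [hs.pow_eq, hs.input.f_eq, pow_succ]
    · rintro a (rfl | rfl | rfl | rfl | rfl) <;> simp [hz]
    · simp [hs.bins_eq]
    · rintro a (rfl | rfl | rfl) <;> simp [hr]
    · simp [hs.draws_eq]
  · have := Nat.le_pow_clog (b := f) (by omega) n
    simp only [Test.eval, NExpr.eval, hs.pow_eq, hs.input.n_eq]
    omega

lemma binInv_reset (hs : HeightInv ε α h (Nat.clog f n) s) :
    BinInv ε α h ω 0 (exec ω resetProg s) := by
  have hz := hs.zero_eq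
  have hr := hs.reals_eq
  refine ⟨hs.input.congr ?_ ?_ ?_ ?_, ?_, ?_, ?_, ?_, ?_, ?_, ?_, ?_, ?_⟩
  · simp [resetProg]
  · simp [resetProg]
  · simp [resetProg]
  · simp [resetProg]
  · simp [resetProg, hs.t_eq, height]
  · rintro a (rfl | rfl | rfl | rfl) <;> simp [resetProg, hz]
  · simp [resetProg, hs.bins_eq]
  · simp [resetProg]
  · simp [resetProg, hz]; rfl
  · simp [resetProg, hr]; rfl
  · simp [resetProg, hr]; rfl
  · simp [resetProg, hr]; rfl
  · simp [resetProg, hs.draws_eq]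

lemma update_prefix {M : Type*} [Zero M] (V : ℕ → M) (i : ℕ) {x : M} (hx : x = V i) :
    Function.update (fun y => if y < i then V y else 0) i x =
      fun y => if y < i + 1 then V y else 0 := by
  funext y
  rcases lt_trichotomy y i with hy | rfl | hy
  · rw [Function.update_of_ne hy.ne, if_pos hy, if_pos (by omega)]
  · simp [hx]
  · rw [Function.update_of_ne hy.ne', if_neg (by omega), if_neg (by omega)]

lemma ends_binLoop (hs : BinInv ε α h ω 0 s) :
    Ends ω binLoop s ((n + 1) * loopCost binLoop) (BinInv ε α h ω n) := by
  refine Ends.loop (by simp [LoopFree]) (fun i hi s hs => ⟨?_, ?_⟩) (fun s hs => ?_) hs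
  · simp only [Test.eval, NExpr.eval, hs.node_eq, hs.input.n_eq]
    omega
  · have hz := hs.zero_eq
    have hb := eval_groupingBudgetExpr hs.input
    have hbin : binArray (fun i => (h i : ℝ)) i + 1 / groupingBudget ε * ω i =
        binArray (noisyBin ε h ω) i := by
      simp [binArray, hi, noisyBin]
    refine ⟨hs.input.congr ?_ ?_ ?_ ?_, ?_, ?_, ?_, ?_, ?_, ?_, ?_, ?_, ?_⟩
    · simp
    · simp
    · simp
    · simp
    · simp [hs.t_eq]
    · rintro a (rfl | rfl | rfl | rfl) <;> simp [hz]
    · simp [hs.bins_eq]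
    · simp [hs.node_eq]
    · simp only [exec, NExpr.eval, setInt_ints, setReal_ints, hs.node_eq, hs.count_eq]
      exact update_prefix (fun _ => 1) i rfl
    · rw [← update_prefix _ i rfl, ← hs.sum_eq, ← hbin]
      simp [hs.node_eq, hs.bins_eq, hb, hs.draws_eq]
    · rw [← update_prefix (fun x => binArray (noisyBin ε h ω) x ^ 2) i rfl, ← hs.sq_eq, ← hbin]
      simp [hs.node_eq, hs.bins_eq, hb, hs.draws_eq, sq]
    · rw [← update_prefix (fun x => groupError n f ε ^ 2) i rfl, ← hs.cost_eq]
      simp [hs.node_eq, groupErrorExpr, groupError, hs.input.ε_eq, hs.t_eq, sq]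
    · simp [hs.draws_eq]
  · simp only [Test.eval, NExpr.eval, hs.node_eq, hs.input.n_eq]
    omega

end Correctness

/-! ### The bottom-up loop -/

section BottomUp

variable {n f : ℕ} {ε : ℝ} {α : Fin (height n f) → ℝ} {h : Fin n → ℕ} {ω : ℕ → ℝ} {s : State}
  {debias : Bool} {K J : ℕ}

/-- The cost of the leaves of a node as a single group, on the noisy bins. -/
def nodeCost (n f : ℕ) (ε : ℝ) (debias : Bool) (b : Fin n → ℝ) (k j : ℕ) : ℝ :=
  groupCost f ε debias b (leavesAt n f k j)

lemma groupCost_eq (ε : ℝ) (debias : Bool) (b : Fin n → ℝ) {g : Finset (Fin n)}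
    (hg : g.Nonempty) : groupCost f ε debias b g =
      ∑ i ∈ g, b i ^ 2 - (∑ i ∈ g, b i) * (∑ i ∈ g, b i) / g.card
        + groupError n f ε * groupError n f ε
        - (if debias then
            2 * ((g.card : ℝ) - 1) / (groupingBudget ε * groupingBudget ε) else 0) := by
  have h0 : (g.card : ℝ) ≠ 0 := by exact_mod_cast (Finset.card_pos.2 hg).ne'
  have h1 : ∑ i ∈ g, (b i - groupAvg b g) ^ 2 =
      ∑ i ∈ g, b i ^ 2 - (∑ i ∈ g, b i) * (∑ i ∈ g, b i) / g.card := by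
    simp only [sub_sq, Finset.sum_add_distrib, Finset.sum_sub_distrib, ← Finset.sum_mul,
      ← Finset.mul_sum, Finset.sum_const, nsmul_eq_mul, groupAvg]
    field_simp
    ring
  rw [groupCost, h1, ← sq (groupError n f ε), ← sq (groupingBudget ε)]

/-- The flag of a node, as a number. -/
def flagBit (n f : ℕ) (c : ℕ → ℕ → ℝ) (k j : ℕ) : ℕ :=
  open Classical in if Flag n f (Cheap n f c) k j then 1 else 0

lemma bestCost_eq (c : ℕ → ℕ → ℝ) (k j : ℕ) : bestCost n f c k j =
    open Classical in if Flag n f (Cheap n f c) k j then c k j else kidsCost n f c k j := by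
  classical
  exact if_congr flag_cheap.symm rfl rfl

/-- The variables of the bottom-up loop when it is at node `J` of level `K`. -/
structure BottomUpVars (n f K J : ℕ) (s : State) : Prop where
  t_eq : s.ints 2 0 = height n f
  level_eq : s.ints 3 0 = K
  pos_eq : s.ints 4 0 = J
  parent_eq : s.ints 5 0 = J / f
  size_eq : s.ints 6 0 = levelSize n f K
  pow_eq : s.ints 7 0 = f ^ K
  node_eq : s.ints 8 0 = offset n f K + J
  next_eq : s.ints 9 0 = offset n f (K + 1)

/-- The arrays of the bottom-up loop when it has processed the nodes before node `J` of level `K`. -/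
structure BottomUpArrays (ε : ℝ) (debias : Bool) (α : Fin (height n f) → ℝ) (h : Fin n → ℕ)
    (ω : ℕ → ℝ) (K J : ℕ) (s : State) : Prop where
  draws_eq : s.draws = n + (offset n f K + J)
  count : Acc n f (fun k j => (leavesAt n f k j).card) (fun k j => (leavesAt n f k j).card) K J
    (s.ints 12)
  bins : Acc n f (fun k j => ∑ i ∈ leavesAt n f k j, (h i : ℝ))
    (fun k j => ∑ i ∈ leavesAt n f k j, (h i : ℝ)) K J (s.reals 2)
  sum : Acc n f (fun k j => ∑ i ∈ leavesAt n f k j, noisyBin ε h ω i)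
    (fun k j => ∑ i ∈ leavesAt n f k j, noisyBin ε h ω i) K J (s.reals 4)
  sq : Acc n f (fun k j => ∑ i ∈ leavesAt n f k j, noisyBin ε h ω i ^ 2)
    (fun k j => ∑ i ∈ leavesAt n f k j, noisyBin ε h ω i ^ 2) K J (s.reals 5)
  cost : Acc n f (kidsCost n f (nodeCost n f ε debias (noisyBin ε h ω)))
    (bestCost n f (nodeCost n f ε debias (noisyBin ε h ω))) K J (s.reals 6)
  done : ∀ k j, j < levelSize n f k → offset n f k + j < offset n f K + J →
    s.ints 10 (offset n f k + j) = offset n f (k + 1) + j / f ∧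
    s.ints 11 (offset n f k + j) =
      flagBit n f (nodeCost n f ε debias (noisyBin ε h ω)) k j ∧
    s.reals 3 (offset n f k + j) = noisyNode ε α h ω k j
  unflagged : ∀ x, offset n f K + J ≤ x → s.ints 11 x = 0

lemma eval_groupCostExpr (hs : HasInput ε α s) (ht : s.ints 2 0 = height n f) {g : Finset (Fin n)}
    (hg : g.Nonempty) {b : Fin n → ℝ} (h1 : s.ints 12 (s.ints 8 0) = g.card)
    (h2 : s.reals 4 (s.ints 8 0) = ∑ i ∈ g, b i)
    (h3 : s.reals 5 (s.ints 8 0) = ∑ i ∈ g, b i ^ 2) :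
    (groupCostExpr debias).eval s = groupCost f ε debias b g := by
  rw [groupCost_eq ε debias b hg]
  have e1 := eval_groupErrorExpr hs ht
  have e2 := eval_groupingBudgetExpr hs
  cases debias <;> simp [groupCostExpr, e1, e2, h1, h2, h3]

/-- The effect of the first part of the body of the bottom-up loop. -/
lemma exec_flagProg {c : ℝ}
    (hc : ∀ s' : State, s'.reals = s.reals → (∀ a, a ≠ 10 → s'.ints a = s.ints a) →
      (groupCostExpr debias).eval s' = c) :
    let s' := exec ω (flagProg debias) s
    let F := s.ints 12 (s.ints 8 0) = s.ints 7 0 ∧ c ≤ s.reals 6 (s.ints 8 0)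
    s'.draws = s.draws ∧
    s'.ints 10 = Function.update (s.ints 10) (s.ints 8 0) (s.ints 9 0 + s.ints 5 0) ∧
    (open Classical in
      s'.ints 11 = if F then Function.update (s.ints 11) (s.ints 8 0) 1 else s.ints 11) ∧
    (∀ a, a ≠ 10 → a ≠ 11 → s'.ints a = s.ints a) ∧
    (∀ a, a ≠ 7 → s'.reals a = s.reals a) ∧
    (open Classical in s'.reals 7 0 = if F then c else s.reals 6 (s.ints 8 0)) := by
  intro s' F
  set s1 := s.setInt 10 (s.ints 8 0) (s.ints 9 0 + s.ints 5 0) with hs1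
  have hc1 : (groupCostExpr debias).eval s1 = c := hc s1 rfl fun a ha => by simp [hs1, ha]
  have hs' : s' = open Classical in
      if F then (s1.setReal 7 0 c).setInt 11 (s.ints 8 0) 1
      else (s1.setReal 7 0 c).setReal 7 0 (s.reals 6 (s.ints 8 0)) := by
    simp only [s', flagProg, exec, NExpr.eval, ← hs1, hc1, flagTest, Test.eval, RExpr.eval]
    simp [hs1, F, le_antisymm_iff]
  rw [hs']
  split_ifs with hF
  · refine ⟨rfl, ?_, ?_, ?_, ?_, ?_⟩
    · simp [hs1]
    · simp [hs1]
    · intro a h1 h2; simp [hs1, h1, h2]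
    · intro a h1; simp [hs1, h1]
    · simp [hs1]
  · refine ⟨rfl, ?_, ?_, ?_, ?_, ?_⟩
    · simp [hs1]
    · simp [hs1]
    · intro a h1 h2; simp [hs1, h1]
    · intro a h1; simp [hs1, h1]
    · simp [hs1]

/-- The effect of the second part of the body of the bottom-up loop. -/
lemma exec_pushProg (hs : HasInput ε α s) (ht : s.ints 2 0 = height n f) :
    let s' := exec ω pushProg s
    let g := s.ints 8 0
    let p := s.ints 10 g
    s'.draws = s.draws + 1 ∧
    (∀ a, a ≠ 12 → s'.ints a = s.ints a) ∧
    s'.ints 12 = Function.update (s.ints 12) p (s.ints 12 p + s.ints 12 g) ∧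
    s'.reals 0 = s.reals 0 ∧ s'.reals 1 = s.reals 1 ∧
    s'.reals 2 = Function.update (s.reals 2) p (s.reals 2 p + s.reals 2 g) ∧
    s'.reals 3 = Function.update (s.reals 3) g
      (s.reals 2 g + 1 / (αArray α (s.ints 3 0) * levelBudget n f ε) * ω s.draws) ∧
    s'.reals 4 = Function.update (s.reals 4) p (s.reals 4 p + s.reals 4 g) ∧
    s'.reals 5 = Function.update (s.reals 5) p (s.reals 5 p + s.reals 5 g) ∧
    s'.reals 6 = Function.update (s.reals 6) p (s.reals 6 p + s.reals 7 0) := by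
  have e := eval_levelBudgetExpr hs ht
  refine ⟨?_, ?_, ?_, ?_, ?_, ?_, ?_, ?_, ?_, ?_⟩
  · simp [pushProg]
  · intro a ha; simp [pushProg, ha]
  all_goals simp [pushProg, e, hs.α_eq]

lemma vars_congr {s' : State} (hv : BottomUpVars n f K J s)
    (h : ∀ a, 2 ≤ a → a ≤ 9 → s'.ints a = s.ints a) : BottomUpVars n f K J s' := by
  constructor <;> rw [h _ (by norm_num) (by norm_num)]
  exacts [hv.t_eq, hv.level_eq, hv.pos_eq, hv.parent_eq, hv.size_eq, hv.pow_eq, hv.node_eq,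
    hv.next_eq]

lemma BottomUpArrays.process (hf : 2 ≤ f) (hi : HasInput ε α s)
    (hv : BottomUpVars n f K J s) (ha : BottomUpArrays ε debias α h ω K J s)
    (hJ : J < levelSize n f K) :
    HasInput ε α (exec ω pushProg (exec ω (flagProg debias) s)) ∧
    BottomUpVars n f K J (exec ω pushProg (exec ω (flagProg debias) s)) ∧
    BottomUpArrays ε debias α h ω K (J + 1) (exec ω pushProg (exec ω (flagProg debias) s)) := by
  classical
  set b := noisyBin ε h ω with hb
  set C := nodeCost n f ε debias b with hC
  have hg : (leavesAt n f K J).Nonempty := exists_mem_leavesAt hf hJ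
  have hcost : ∀ s' : State, s'.reals = s.reals → (∀ a, a ≠ 10 → s'.ints a = s.ints a) →
      (groupCostExpr debias).eval s' = C K J := by
    intro s' hr hi'
    refine eval_groupCostExpr (hi.congr (hi' _ (by norm_num)) (hi' _ (by norm_num)) (by rw [hr])
      (by rw [hr])) (by rw [hi' _ (by norm_num), hv.t_eq]) hg ?_ ?_ ?_
    · rw [hi' _ (by norm_num), hi' _ (by norm_num), hv.node_eq, ha.count.value hJ]
    · rw [hi' _ (by norm_num), hr, hv.node_eq, ha.sum.value hJ]
    · rw [hi' _ (by norm_num), hr, hv.node_eq, ha.sq.value hJ]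
  obtain ⟨a1, a2, a3, a4, a5, a6⟩ := exec_flagProg (ω := ω) hcost
  set s1 := exec ω (flagProg debias) s with hs1
  have hFiff : (s.ints 12 (s.ints 8 0) = s.ints 7 0 ∧ C K J ≤ s.reals 6 (s.ints 8 0)) ↔
      Flag n f (Cheap n f C) K J := by
    rw [flag_cheap, hv.node_eq, hv.pow_eq, ha.count.value hJ, ha.cost.value hJ, FullAt]
  simp only [hFiff] at a3 a6
  have hi1 : HasInput ε α s1 := hi.congr (a4 _ (by norm_num) (by norm_num))
    (a4 _ (by norm_num) (by norm_num)) (a5 _ (by norm_num)) (a5 _ (by norm_num))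
  have hv1 : BottomUpVars n f K J s1 :=
    vars_congr hv fun a h1 h2 => a4 a (by omega) (by omega)
  obtain ⟨b1, b2, b3, b4, b5, b6, b7, b8, b9, b10⟩ := exec_pushProg (ω := ω) hi1 hv1.t_eq
  set s2 := exec ω pushProg s1 with hs2
  have hp : s1.ints 10 (s1.ints 8 0) = offset n f (K + 1) + J / f := by
    rw [a2, hv1.node_eq, hv.node_eq, Function.update_self, hv.next_eq, hv.parent_eq]
  rw [hp, hv1.node_eq] at b3 b6 b8 b9
  rw [hp] at b10
  rw [hv1.node_eq] at b7
  rw [a4 12 (by norm_num) (by norm_num)] at b3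
  rw [a5 _ (by norm_num)] at b6 b8 b9 b10
  rw [a5 2 (by norm_num), ha.bins.value hJ, hv1.level_eq, a1, ha.draws_eq] at b7
  refine ⟨hi1.congr (b2 _ (by norm_num)) (b2 _ (by norm_num)) b4 b5,
    vars_congr hv1 fun a h1 h2 => b2 a (by omega), ?_, ?_, ?_, ?_, ?_, ?_, ?_, ?_⟩
  · rw [b1, a1, ha.draws_eq]; ring
  · rw [b3]; exact ha.count.succ (ha.count.value hJ)
  · rw [b6]; exact ha.bins.succ (ha.bins.value hJ)
  · rw [b8]; exact ha.sum.succ (ha.sum.value hJ)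
  · rw [b9]; exact ha.sq.succ (ha.sq.value hJ)
  · rw [b10]
    refine ha.cost.succ ?_
    rw [a6, bestCost_eq, hv.node_eq, ha.cost.value hJ]
  · intro k j hj hlt
    rw [b2 10 (by norm_num), b2 11 (by norm_num), a2, a3, b7, hv.node_eq, hv.next_eq, hv.parent_eq]
    rcases (show offset n f k + j ≤ offset n f K + J by omega).eq_or_lt with he | hlt'
    · obtain ⟨rfl, rfl⟩ := offset_inj hj hJ he
      refine ⟨by rw [Function.update_self], ?_, ?_⟩
      · rw [flagBit]
        split_ifs
        · rw [Function.update_self]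
        · exact ha.unflagged _ le_rfl
      · rw [Function.update_self, noisyNode]
    · obtain ⟨d1, d2, d3⟩ := ha.done k j hj hlt'
      rw [Function.update_of_ne hlt'.ne, Function.update_of_ne hlt'.ne, d1, ← d2]
      refine ⟨rfl, ?_, ?_⟩
      · split_ifs
        · rw [Function.update_of_ne hlt'.ne]
        · rfl
      · rw [a5 3 (by norm_num)]; exact d3
  · intro x hx
    rw [b2 11 (by norm_num), a3, hv.node_eq]
    split_ifs
    · rw [Function.update_of_ne (by omega)]; exact ha.unflagged x (by omega)
    · exact ha.unflagged x (by omega)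

/-- The program changes only the variables in the integer arrays `3` to `9`. -/
def SetsOnlyVars : Prog → Prop
  | .setInt a _ _ => 3 ≤ a ∧ a ≤ 9
  | .seq p q => SetsOnlyVars p ∧ SetsOnlyVars q
  | .ite _ p q => SetsOnlyVars p ∧ SetsOnlyVars q
  | _ => False

lemma SetsOnlyVars.frame {p : Prog} (hp : SetsOnlyVars p) (s : State) :
    (exec ω p s).draws = s.draws ∧ (exec ω p s).reals = s.reals ∧
    (∀ a, a < 3 ∨ 9 < a → (exec ω p s).ints a = s.ints a) := by
  induction p generalizing s with
  | setInt a i x =>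
    refine ⟨rfl, rfl, fun a' ha' => ?_⟩
    have := hp.1
    have := hp.2
    rw [exec, setInt_ints, if_neg (by omega)]
  | seq p q ihp ihq =>
    obtain ⟨h1, h2, h3⟩ := ihp hp.1 s
    obtain ⟨g1, g2, g3⟩ := ihq hp.2 (exec ω p s)
    exact ⟨g1.trans h1, g2.trans h2, fun a ha => (g3 a ha).trans (h3 a ha)⟩
  | ite c p q ihp ihq =>
    rw [exec]
    split_ifs
    exacts [ihp hp.1 s, ihq hp.2 s]
  | _ => exact hp.elim

lemma BottomUpVars.advance (hn : 0 < n) (hf : 2 ≤ f) (hi : HasInput ε α s)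
    (hv : BottomUpVars n f K J s) :
    (J + 1 < levelSize n f K → BottomUpVars n f K (J + 1) (exec ω advanceProg s)) ∧
    (J + 1 = levelSize n f K → BottomUpVars n f (K + 1) 0 (exec ω advanceProg s)) := by
  have hfe := hi.f_eq
  obtain ⟨v1, v2, v3, v4, v5, v6, v7, v8⟩ := hv
  constructor
  · intro hlt
    -- the parent changes when the position is a multiple of the fan-out
    have hq : (J + 1) / f = if (J / f + 1) * f ≤ J + 1 then J / f + 1 else J / f := by
      have h1 := Nat.div_mul_le_self J f
      have h2 := Nat.lt_div_mul_add (a := J) (b := f) (by omega)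
      have h3 : (J / f + 1) * f = J / f * f + f := by ring
      split_ifs with hc
      · refine Nat.div_eq_of_lt_le hc ?_
        rw [add_mul, one_mul]; omega
      · exact Nat.div_eq_of_lt_le (by omega) (by omega)
    by_cases hc : (J / f + 1) * f ≤ J + 1
    · rw [if_pos hc] at hq
      constructor <;>
        simp [advanceProg, v1, v2, v3, v4, v5, v6, v7, v8, hfe, hc, hq,
          show J + 2 ≤ levelSize n f K from hlt, add_assoc]
    · rw [if_neg hc] at hq
      constructor <;>
        simp [advanceProg, v1, v2, v3, v4, v5, v6, v7, v8, hfe, hc, hq,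
          show J + 2 ≤ levelSize n f K from hlt, add_assoc]
  · intro he
    have hsize : levelSize n f (K + 1) = J / f + 1 := by
      rw [levelSize_succ hn hf, ← he, Nat.add_sub_cancel]
    have hnot : ¬ J + 2 ≤ levelSize n f K := by omega
    have hoff := offset_succ (n := n) (f := f) K
    have hoff' := offset_succ (n := n) (f := f) (K + 1)
    constructor <;>
      simp [advanceProg, v1, v2, v3, v4, v5, v6, v7, v8, hfe, hnot, hsize, hoff', pow_succ]
    omega

lemma BottomUpArrays.congr {s' : State} (ha : BottomUpArrays ε debias α h ω K J s)
    (h1 : s'.draws = s.draws) (h2 : s'.reals = s.reals) (h3 : ∀ a, 9 < a → s'.ints a = s.ints a) :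
    BottomUpArrays ε debias α h ω K J s' := by
  obtain ⟨a1, a2, a3, a4, a5, a6, a7, a8⟩ := ha
  constructor
  · rwa [h1]
  · rwa [h3 _ (by norm_num)]
  · rwa [h2]
  · rwa [h2]
  · rwa [h2]
  · rwa [h2]
  · rwa [h2, h3 _ (by norm_num), h3 _ (by norm_num)]
  · rwa [h3 _ (by norm_num)]

lemma BottomUpArrays.next (hf : 2 ≤ f)
    (ha : BottomUpArrays ε debias α h ω K (levelSize n f K) s) :
    BottomUpArrays ε debias α h ω (K + 1) 0 s := by
  obtain ⟨a1, a2, a3, a4, a5, a6, a7, a8⟩ := ha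
  have ho : offset n f (K + 1) + 0 = offset n f K + levelSize n f K := by rw [offset_succ, add_zero]
  constructor
  · rwa [ho]
  · refine Acc.next hf (fun k q => ?_) a2
    simp only [Finset.card_eq_sum_ones]
    exact sum_leavesAt_succ hf _ k q
  · exact Acc.next hf (fun k q => sum_leavesAt_succ hf _ k q) a3
  · exact Acc.next hf (fun k q => sum_leavesAt_succ hf _ k q) a4
  · exact Acc.next hf (fun k q => sum_leavesAt_succ hf _ k q) a5
  · exact Acc.next hf (fun k q => kidsCost_succ _ k q) a6
  · rwa [ho]
  · rwa [ho]

/-- The state of the bottom-up loop after `i` iterations. -/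
def BottomUpInv (ε : ℝ) (debias : Bool) (α : Fin (height n f) → ℝ) (h : Fin n → ℕ)
    (ω : ℕ → ℝ) (i : ℕ) (s : State) : Prop :=
  HasInput ε α s ∧ ∃ K J, K ≤ height n f ∧ J < levelSize n f K ∧ offset n f K + J = i ∧
    BottomUpVars n f K J s ∧ BottomUpArrays ε debias α h ω K J s

lemma ends_bottomUpLoop (hn : 0 < n) (hf : 2 ≤ f) (hs : BottomUpInv ε debias α h ω 0 s) :
    Ends ω (bottomUpLoop debias) s
      ((offset n f (height n f) + 1) * loopCost (bottomUpLoop debias))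
      (BottomUpInv ε debias α h ω (offset n f (height n f))) := by
  refine Ends.loop (by simp [LoopFree, flagProg, pushProg, advanceProg])
    (fun i hi s hs => ?_) (fun s hs => ?_) hs
  · obtain ⟨hin, K, J, hK, hJ, rfl, hv, ha⟩ := hs
    have hKlt : K < height n f := by
      refine lt_of_le_of_ne hK ?_
      rintro rfl
      omega
    refine ⟨?_, ?_⟩
    · simp only [Test.eval, NExpr.eval, hv.level_eq, hv.t_eq]
      omega
    · obtain ⟨hin', hv', ha'⟩ := ha.process (ω := ω) hf hin hv hJ
      simp only [exec]
      set s1 := exec ω pushProg (exec ω (flagProg debias) s)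
      obtain ⟨f1, f2, f3⟩ := SetsOnlyVars.frame (ω := ω) (p := advanceProg)
        (by simp [SetsOnlyVars, advanceProg]) s1
      have ha'' := ha'.congr f1 f2 fun a h => f3 a (Or.inr h)
      obtain ⟨g1, g2⟩ := hv'.advance (ω := ω) hn hf hin'
      refine ⟨hin'.congr (f3 _ (by norm_num)) (f3 _ (by norm_num)) (by rw [f2]) (by rw [f2]), ?_⟩
      rcases (Nat.succ_le_of_lt hJ).lt_or_eq with hlt | he
      · exact ⟨K, J + 1, hK, hlt, by omega, g1 hlt, ha''⟩
      · refine ⟨K + 1, 0, hKlt, levelSize_pos hn hf _, ?_, g2 he, ?_⟩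
        · rw [offset_succ]; omega
        · rw [show J + 1 = levelSize n f K from he] at ha''
          exact ha''.next hf
  · obtain ⟨hin, K, J, hK, hJ, he, hv, ha⟩ := hs
    have : K = height n f := by
      by_contra hne
      have := offset_add_lt (n := n) (f := f) (lt_of_le_of_ne hK hne) hJ
      omega
    simp only [Test.eval, NExpr.eval, hv.level_eq, hv.t_eq]
    omega

lemma sum_leavesAt_zero {w : Fin n → ℝ} {j : ℕ} (hj : j < n) :
    ∑ i ∈ leavesAt n f 0 j, w i = w ⟨j, hj⟩ := by
  have : leavesAt n f 0 j = {⟨j, hj⟩} := by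
    ext i; simp [Fin.ext_iff]
  rw [this, Finset.sum_singleton]

lemma acc_zero {M : Type*} [AddCommMonoid M] {A V : ℕ → ℕ → M} {arr : ℕ → M}
    (h1 : ∀ j < n, arr j = A 0 j) (h2 : ∀ x, n ≤ x → arr x = 0) : Acc n f A V 0 0 arr := by
  constructor
  · intro j _ hj
    rw [levelSize_zero] at hj
    rw [offset_zero, zero_add, h1 j hj]
  · intro q
    rw [offset_succ, offset_zero, levelSize_zero, h2 _ (by omega)]
    simp

lemma nodeCost_zero (hf : 2 ≤ f) (b : Fin n → ℝ) {j : ℕ} (hj : j < n) :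
    nodeCost n f ε debias b 0 j = groupError n f ε ^ 2 := by
  have hc : (leavesAt n f 0 j).card = 1 := by simpa [FullAt] using fullAt_zero hf hj
  rw [nodeCost, groupCost_eq _ _ _ (Finset.card_pos.1 (by omega)), sum_leavesAt_zero hj,
    sum_leavesAt_zero hj, hc]
  simp [sq]

lemma bottomUpInv_reset (hn : 0 < n) (hf : 2 ≤ f) (hs : BinInv ε α h ω n s) :
    BottomUpInv ε debias α h ω 0 (exec ω resetProg s) := by
  have hz := hs.zero_eq
  refine ⟨hs.input.congr ?_ ?_ ?_ ?_, 0, 0, Nat.zero_le _, levelSize_pos hn hf 0, rfl, ?_, ?_⟩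
  · simp [resetProg]
  · simp [resetProg]
  · simp [resetProg]
  · simp [resetProg]
  · constructor <;> simp [resetProg, hs.t_eq, hz, hs.input.n_eq, levelSize_zero, offset_zero,
      offset_succ]
  · constructor
    · simp [resetProg, hs.draws_eq, offset_zero]
    · have : (exec ω resetProg s).ints 12 = s.ints 12 := by simp [resetProg]
      rw [this, hs.count_eq]
      refine acc_zero (fun j hj => ?_) fun x hx => by simp [hx]
      have := fullAt_zero (n := n) hf hj
      rw [FullAt, pow_zero] at this
      rw [if_pos hj, this]
    · have : (exec ω resetProg s).reals 2 = s.reals 2 := by simp [resetProg]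
      rw [this, hs.bins_eq]
      exact acc_zero (fun j hj => by rw [sum_leavesAt_zero hj, binArray, dif_pos hj])
        fun x hx => by rw [binArray, dif_neg (by omega)]
    · have : (exec ω resetProg s).reals 4 = s.reals 4 := by simp [resetProg]
      rw [this, hs.sum_eq]
      exact acc_zero (fun j hj => by rw [sum_leavesAt_zero hj, if_pos hj, binArray, dif_pos hj])
        fun x hx => by rw [if_neg (by omega)]
    · have : (exec ω resetProg s).reals 5 = s.reals 5 := by simp [resetProg]
      rw [this, hs.sq_eq]
      exact acc_zero (fun j hj => by rw [sum_leavesAt_zero hj, if_pos hj, binArray, dif_pos hj])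
        fun x hx => by rw [if_neg (by omega)]
    · have : (exec ω resetProg s).reals 6 = s.reals 6 := by simp [resetProg]
      rw [this, hs.cost_eq]
      exact acc_zero (fun j hj => by rw [kidsCost, nodeCost_zero hf _ hj, if_pos hj])
        fun x hx => by rw [if_neg (by omega)]
    · intro k j _ hlt
      rw [offset_zero] at hlt
      omega
    · intro x _
      simp [resetProg, hz]

end BottomUp

/-! ### The top-down loop and the running time -/

section TopDown

variable {n f : ℕ} {ε : ℝ} {α : Fin (height n f) → ℝ} {h : Fin n → ℕ} {ω : ℕ → ℝ} {s : State}
  {debias : Bool}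

/-- The position of a node in the arrays of the program. -/
def nodeId (v : Node n f) : ℕ := offset n f v.1 + v.2

lemma nodeId_lt (v : Node n f) : nodeId v < offset n f (height n f) :=
  offset_add_lt v.1.2 v.2.2

lemma exists_nodeId {x : ℕ} (hx : x < offset n f (height n f)) :
    ∃ v : Node n f, nodeId v = x := by
  have key : ∀ t, t ≤ height n f → x < offset n f t → ∃ v : Node n f, nodeId v = x := by
    intro t
    induction t with
    | zero => intro _ h; exact absurd h (Nat.not_lt_zero _)
    | succ t ih =>
      intro ht hxt
      by_cases hlt : x < offset n f t
      · exact ih (by omega) hlt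
      · rw [offset_succ] at hxt
        exact ⟨⟨⟨t, ht⟩, ⟨x - offset n f t, by simp only; omega⟩⟩, by simp only [nodeId]; omega⟩
  exact key _ le_rfl hx

lemma nodeId_injective : Function.Injective (nodeId : Node n f → ℕ) := fun v w hvw =>
  have h := offset_inj v.2.2 w.2.2 hvw
  node_ext h.1 h.2

/-- The grouping that results from the variates `ω`. -/
def outGrouping (hf : 2 ≤ f) (ε : ℝ) (debias : Bool) (h : Fin n → ℕ) (ω : ℕ → ℝ) : Grouping n f :=
  optSel hf ε debias (noisyBin ε h ω)

/-- The tree that results from the variates `ω`: the first `n` of them perturb the bins, the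
following ones the nodes, whether these are pruned or not. -/
def outTree (hf : 2 ≤ f) (ε : ℝ) (debias : Bool) (α : Fin (height n f) → ℝ) (h : Fin n → ℕ)
    (ω : ℕ → ℝ) : Tree n f :=
  assemble (outGrouping hf ε debias h ω) fun k j => (noisyNode ε α h ω k j : EReal)

/-- The node is flagged for the costs that result from the variates `ω`. -/
def IsFlagged (ε : ℝ) (debias : Bool) (h : Fin n → ℕ) (ω : ℕ → ℝ) (v : Node n f) : Prop :=
  Flag n f (Cheap n f (nodeCost n f ε debias (noisyBin ε h ω))) v.1 v.2

open Classical in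
/-- The state of the top-down loop when it has processed the nodes from number `g` on. -/
structure TopDownInv (hf : 2 ≤ f) (ε : ℝ) (debias : Bool) (α : Fin (height n f) → ℝ)
    (h : Fin n → ℕ) (ω : ℕ → ℝ) (g : ℕ) (s : State) : Prop where
  f_eq : s.ints 1 0 = f
  node_eq : s.ints 8 0 = g
  parent_eq : ∀ v : Node n f, s.ints 10 (nodeId v) = offset n f (v.1 + 1) + v.2 / f
  root_eq : s.ints 11 (offset n f (height n f)) = 0
  done_flag : ∀ v : Node n f, g ≤ nodeId v → s.ints 11 (nodeId v) =
    if IsFlagged ε debias h ω v ∨ IsPruned (outGrouping hf ε debias h ω) v then 1 else 0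
  done_value : ∀ v : Node n f, g ≤ nodeId v →
    s.reals 3 (nodeId v) = outTree hf ε debias α h ω v.1 v.2
  todo_flag : ∀ v : Node n f, nodeId v < g → s.ints 11 (nodeId v) =
    if IsFlagged ε debias h ω v then 1 else 0
  todo_value : ∀ v : Node n f, nodeId v < g → s.reals 3 (nodeId v) = noisyNode ε α h ω v.1 v.2

lemma topDownInv_of_bottomUpInv (hf : 2 ≤ f)
    (hs : BottomUpInv ε debias α h ω (offset n f (height n f)) s) :
    TopDownInv hf ε debias α h ω (offset n f (height n f)) s := by
  obtain ⟨hin, K, J, hK, hJ, he, hv, ha⟩ := hs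
  have hd := fun v : Node n f => ha.done v.1 v.2 v.2.2 (by rw [he]; exact nodeId_lt v)
  refine ⟨hin.f_eq, by rw [hv.node_eq, he], fun v => (hd v).1, ha.unflagged _ he.le,
    fun v hv => absurd (nodeId_lt v) (by omega), fun v hv => absurd (nodeId_lt v) (by omega),
    fun v _ => (hd v).2.1, fun v _ => (hd v).2.2⟩

/-- The flag of the parent tells whether a node is pruned. -/
lemma TopDownInv.parent_flag (hf : 2 ≤ f) {g : ℕ}
    (hs : TopDownInv hf ε debias α h ω (g + 1) s) {v : Node n f} (hv : nodeId v = g) :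
    (1 ≤ s.ints 11 (s.ints 10 g) ↔ IsPruned (outGrouping hf ε debias h ω) v) ∧
    (IsPruned (outGrouping hf ε debias h ω) v →
      outTree hf ε debias α h ω v.1 v.2 = s.reals 3 (s.ints 10 g) / f) := by
  classical
  subst hv
  rw [hs.parent_eq]
  rcases (Nat.succ_le_of_lt v.1.2).lt_or_eq with hlt | he
  · set p : Node n f := ⟨⟨v.1 + 1, hlt⟩, ⟨v.2 / f, div_lt_levelSize_succ hf v.2.2⟩⟩ with hp
    have hpid : offset n f (v.1 + 1) + v.2 / f = nodeId p := rfl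
    have hle : nodeId v + 1 ≤ nodeId p := by
      have := offset_add_lt (n := n) (f := f) (Nat.lt_succ_self (v.1 : ℕ)) v.2.2
      exact (Nat.succ_le_of_lt this).trans (Nat.le_add_right _ _)
    rw [hpid, hs.done_flag p hle, hs.done_value p hle]
    have hiff := isPruned_iff_parent hf (Cheap n f (nodeCost n f ε debias (noisyBin ε h ω)))
      (v := v) (p := p) rfl rfl
    refine ⟨?_, fun h => assemble_of_isPruned hf h rfl rfl _⟩
    refine Iff.trans ?_ hiff.symm
    change _ ↔ IsFlagged ε debias h ω p ∨ IsPruned (outGrouping hf ε debias h ω) p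
    split_ifs with hc <;> simp [hc]
  · have hroot : (v.2 : ℕ) / f = 0 := by
      have h1 := div_lt_levelSize_succ hf v.2.2
      have h2 : (v.1 : ℕ) + 1 = height n f := he
      rw [h2] at h1
      generalize (v.2 : ℕ) / f = q at h1 ⊢
      by_contra hne
      have h3 := (lt_levelSize hf).1 (show 1 < levelSize n f (height n f) by omega)
      have h4 : n ≤ f ^ height n f := (Nat.le_pow_clog (by omega) n).trans
        (Nat.pow_le_pow_right (by omega) (Nat.le_succ _))
      omega
    have hnot : ¬ IsPruned (outGrouping hf ε debias h ω) v := by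
      intro hp
      obtain ⟨r, -, ha⟩ := hp
      have h1 := ha.1
      have h2 := r.1.2
      have h3 : (v.1 : ℕ) + 1 = height n f := he
      omega
    have h2 : (v.1 : ℕ) + 1 = height n f := he
    rw [hroot, h2, add_zero, hs.root_eq]
    exact ⟨by simp [hnot], fun h => absurd h hnot⟩

lemma ends_topDownLoop (hf : 2 ≤ f)
    (hs : TopDownInv hf ε debias α h ω (offset n f (height n f)) s) :
    Ends ω topDownLoop s ((offset n f (height n f) + 1) * loopCost topDownLoop)
      (TopDownInv hf ε debias α h ω 0) := by
  classical
  set N := offset n f (height n f) with hN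
  have := Ends.loop (ω := ω) (c := .natLe (.const 1) (var 8))
    (p := .seq (.setInt 8 (.const 0) (.sub (var 8) (.const 1)))
      (.ite (.natLe (.const 1) (.load 11 (.load 10 (var 8))))
        (.seq (.setInt 11 (var 8) (.const 1))
          (.setReal 3 (var 8) (.div (.load 3 (.load 10 (var 8))) (.cast (var 1)))))
        (.setInt 8 (.const 0) (var 8)))) (by simp [LoopFree])
    (Inv := fun i => TopDownInv hf ε debias α h ω (N - i)) (m := N) (s := s) ?_ ?_ hs
  · simp only [Nat.sub_self] at this
    exact this
  · intro i hi s hs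
    obtain ⟨g, hg⟩ : ∃ g, N - i = g + 1 := ⟨N - i - 1, by omega⟩
    have hg' : N - (i + 1) = g := by omega
    rw [hg] at hs
    rw [hg']
    refine ⟨by simp [hs.node_eq], ?_⟩
    obtain ⟨v, hv⟩ := exists_nodeId (n := n) (f := f) (x := g) (by omega)
    obtain ⟨hflag, hval⟩ := hs.parent_flag hf hv
    have hne : ∀ w : Node n f, w ≠ v → nodeId w ≠ g := fun w hw hwg =>
      hw (nodeId_injective (hwg.trans hv.symm))
    set s1 := s.setInt 8 0 g with hs1
    have hexec : exec ω (.seq (.setInt 8 (.const 0) (.sub (var 8) (.const 1)))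
        (.ite (.natLe (.const 1) (.load 11 (.load 10 (var 8))))
          (.seq (.setInt 11 (var 8) (.const 1))
            (.setReal 3 (var 8) (.div (.load 3 (.load 10 (var 8))) (.cast (var 1)))))
          (.setInt 8 (.const 0) (var 8)))) s =
        if IsPruned (outGrouping hf ε debias h ω) v then
          (s1.setInt 11 g 1).setReal 3 g (outTree hf ε debias α h ω v.1 v.2)
        else s1.setInt 8 0 g := by
      simp only [exec, NExpr.eval, hs.node_eq, Nat.add_sub_cancel, ← hs1, Test.eval, RExpr.eval]
      rw [show s1.ints 8 0 = g by simp [hs1], show s1.ints 10 = s.ints 10 by simp [hs1],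
        show s1.ints 11 = s.ints 11 by simp [hs1]]
      split_ifs with h1 h2 h2
      · rw [hval h2]
        simp [hs1, hs.f_eq]
      · exact absurd (hflag.1 h1) h2
      · exact absurd (hflag.2 h2) h1
      · rfl
    rw [hexec]
    split_ifs with hp
    · constructor
      · simp [hs1, hs.f_eq]
      · simp [hs1]
      · simpa [hs1] using hs.parent_eq
      · simp only [setReal_ints, setInt_ints, if_true]
        rw [Function.update_of_ne (by omega)]
        simpa [hs1] using hs.root_eq
      · intro w hw
        simp only [setReal_ints, setInt_ints, if_true]
        by_cases hwv : w = v
        · subst hwv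
          rw [hv, Function.update_self, if_pos (Or.inr hp)]
        · have := hne w hwv
          rw [Function.update_of_ne this]
          simpa [hs1] using hs.done_flag w (by omega)
      · intro w hw
        simp only [setReal_reals, if_true]
        by_cases hwv : w = v
        · subst hwv
          rw [hv, Function.update_self]
        · have := hne w hwv
          rw [Function.update_of_ne this]
          simpa [hs1] using hs.done_value w (by omega)
      · intro w hw
        simp only [setReal_ints, setInt_ints, if_true]
        rw [Function.update_of_ne (by omega)]
        simpa [hs1] using hs.todo_flag w (by omega)
      · intro w hw
        simp only [setReal_reals, if_true]
        rw [Function.update_of_ne (by omega)]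
        simpa [hs1] using hs.todo_value w (by omega)
    · constructor
      · simp [hs1, hs.f_eq]
      · simp
      · simpa [hs1] using hs.parent_eq
      · simpa [hs1] using hs.root_eq
      · intro w hw
        have h11 : (s1.setInt 8 0 g).ints 11 = s.ints 11 := by simp [hs1]
        rw [h11]
        by_cases hwv : w = v
        · subst hwv
          rw [hs.todo_flag w (by omega)]
          simp [hp]
        · have := hne w hwv
          exact hs.done_flag w (by omega)
      · intro w hw
        have h3 : (s1.setInt 8 0 g).reals 3 = s.reals 3 := by simp [hs1]
        rw [h3]
        by_cases hwv : w = v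
        · subst hwv
          rw [hs.todo_value w (by omega), outTree, assemble_of_not_isPruned hp, EReal.toReal_coe]
        · have := hne w hwv
          exact hs.done_value w (by omega)
      · intro w hw
        simpa [hs1] using hs.todo_flag w (by omega)
      · intro w hw
        simpa [hs1] using hs.todo_value w (by omega)
  · intro s hs
    simp [hs.node_eq]

/-- A bound for the running time of the program, per bin. -/
def stepsPerBin (debias : Bool) : ℕ :=
  100 + 2 * loopCost heightLoop + 2 * loopCost binLoop + 4 * loopCost (bottomUpLoop debias) +
    4 * loopCost topDownLoop

/-- The program computes `outTree` in linear time. -/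
lemma ends_treeProg (hn : 0 < n) (hf : 2 ≤ f) (ε : ℝ) (debias : Bool) (α : Fin (height n f) → ℝ)
    (h : Fin n → ℕ) (ω : ℕ → ℝ) :
    Ends ω (treeProg debias) (initState ε α h) (stepsPerBin debias * n)
      (fun s => outputTree n f s = outTree hf ε debias α h ω) := by
  have h1 := Ends.of_exec (ω := ω) (p := .seq (.setInt 7 (.const 0) (.const 1))
    (.setInt 2 (.const 0) (.const 1))) (by simp [LoopFree]) (heightInv_initState (ε := ε) (α := α)
      (h := h) (ω := ω))
  have hlf : LoopFree resetProg := by simp [LoopFree, resetProg]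
  obtain ⟨s', T, hr, hT, hs⟩ := h1.seq fun s hs => (ends_heightLoop hf hs).seq fun s hs =>
    (Ends.of_exec hlf (binInv_reset (ω := ω) hs)).seq fun s hs =>
    (ends_binLoop hs).seq fun s hs =>
    (Ends.of_exec hlf (bottomUpInv_reset (debias := debias) hn hf hs)).seq fun s hs =>
    (ends_bottomUpLoop hn hf hs).seq fun s hs =>
    ends_topDownLoop hf (topDownInv_of_bottomUpInv hf hs)
  refine ⟨s', T, hr, hT.trans ?_, ?_⟩
  · have hN := offset_height_le hn hf
    have hclog : Nat.clog f n ≤ n :=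
      (Nat.clog_le_iff_le_pow (by omega)).2 (Nat.lt_pow_self (by omega)).le
    have e1 : (Nat.clog f n + 1) * loopCost heightLoop ≤ (2 * n) * loopCost heightLoop :=
      Nat.mul_le_mul_right _ (by omega)
    have e2 : (n + 1) * loopCost binLoop ≤ (2 * n) * loopCost binLoop :=
      Nat.mul_le_mul_right _ (by omega)
    have e3 : (offset n f (height n f) + 1) * loopCost (bottomUpLoop debias) ≤
        (4 * n) * loopCost (bottomUpLoop debias) := Nat.mul_le_mul_right _ (by omega)
    have e4 : (offset n f (height n f) + 1) * loopCost topDownLoop ≤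
        (4 * n) * loopCost topDownLoop := Nat.mul_le_mul_right _ (by omega)
    have e5 : maxCost resetProg ≤ 40 := by
      simp [maxCost, resetProg, NExpr.cost]
    have e6 : maxCost
        (.seq (.setInt 7 (.const 0) (.const 1)) (.setInt 2 (.const 0) (.const 1))) ≤ 20 := by
      simp [maxCost, NExpr.cost]
    have e7 : stepsPerBin debias * n = 100 * n + (2 * n) * loopCost heightLoop +
        (2 * n) * loopCost binLoop + (4 * n) * loopCost (bottomUpLoop debias) +
        (4 * n) * loopCost topDownLoop := by
      rw [stepsPerBin]; ring
    omega
  · funext k j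
    exact hs.done_value ⟨k, j⟩ (Nat.zero_le _)

end TopDown

/-! ### The law of the output -/

/-- Finitely many distinct coordinates of a sequence of independent variates are independent. -/
lemma map_infinitePi_comp {X ι : Type*} [MeasurableSpace X] [Fintype ι] (μ : Measure X)
    [IsProbabilityMeasure μ] {e : ι → ℕ} (he : Function.Injective e) :
    (Measure.infinitePi fun _ : ℕ => μ).map (fun ω i => ω (e i)) = Measure.pi fun _ : ι => μ := by
  classical
  refine (Measure.pi_eq fun s hs => ?_).symm
  rw [Measure.map_apply (by fun_prop) (MeasurableSet.univ_pi hs)]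
  have hpre : (fun (ω : ℕ → X) i => ω (e i)) ⁻¹' Set.univ.pi s =
      Set.pi (Finset.univ.image e : Finset ℕ) (Function.extend e s fun _ => Set.univ) := by
    ext ω
    simp [Set.mem_pi, he.extend_apply]
  rw [hpre, Measure.infinitePi_pi, Finset.prod_image he.injOn]
  · simp [he.extend_apply]
  · intro m hm
    obtain ⟨i, -, rfl⟩ := Finset.mem_image.1 hm
    rw [he.extend_apply]
    exact hs i

section Law

variable {n f : ℕ} {ε : ℝ} {α : Fin (height n f) → ℝ}

/-- The law of independent standard Laplace variates for the bins. -/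
def binNoise (n : ℕ) : Measure (Fin n → ℝ) := Measure.pi fun _ => laplace 1

/-- The law of independent standard Laplace variates for the nodes. -/
def treeNoise (n f : ℕ) : Measure (Tree n f) := Measure.pi fun _ => Measure.pi fun _ => laplace 1

instance : IsProbabilityMeasure (binNoise n) := by unfold binNoise; infer_instance
instance : IsProbabilityMeasure (treeNoise n f) := by unfold treeNoise; infer_instance

/-- The variates that the program uses for the bins and for the nodes. -/
def splitVariates (n f : ℕ) (ω : ℕ → ℝ) : (Fin n → ℝ) × Tree n f :=
  (fun i => ω i, fun k j => ω (n + (offset n f k + j)))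

lemma measurable_splitVariates : Measurable (splitVariates n f) := by
  unfold splitVariates; fun_prop

lemma map_splitVariates : (Measure.infinitePi fun _ : ℕ => laplace 1).map (splitVariates n f) =
    (binNoise n).prod (treeNoise n f) := by
  let e : Fin n ⊕ Node n f → ℕ := Sum.elim (fun i => i) (fun v => n + nodeId v)
  have he : Function.Injective e := by
    rintro (i | v) (i' | v') hvv
    · exact congrArg Sum.inl (Fin.ext hvv)
    · have := i.2; simp only [e, Sum.elim_inl, Sum.elim_inr] at hvv; omega
    · have := i'.2; simp only [e, Sum.elim_inl, Sum.elim_inr] at hvv; omega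
    · simp only [e, Sum.elim_inr] at hvv
      exact congrArg Sum.inr (nodeId_injective (by omega))
  have hcurry : (Measure.pi fun _ : Node n f => laplace 1).map
      (MeasurableEquiv.piCurry fun (k : Fin (height n f)) (_ : Fin (levelSize n f k)) => ℝ) =
      treeNoise n f := by
    have := Measure.infinitePi_map_piCurry
      (fun (k : Fin (height n f)) (_ : Fin (levelSize n f k)) => laplace 1)
    simp only [Measure.infinitePi_eq_pi] at this
    exact this
  have hsum := (measurePreserving_sumPiEquivProdPi
    (fun _ : Fin n ⊕ Node n f => laplace 1)).map_eq
  have hcomp : splitVariates n f = Prod.map id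
      (MeasurableEquiv.piCurry fun (k : Fin (height n f)) (_ : Fin (levelSize n f k)) => ℝ) ∘
      MeasurableEquiv.sumPiEquivProdPi (fun _ : Fin n ⊕ Node n f => ℝ) ∘ fun ω i => ω (e i) := rfl
  rw [hcomp, ← Measure.map_map (by fun_prop) (by fun_prop),
    ← Measure.map_map (by fun_prop) (by fun_prop), map_infinitePi_comp _ he, hsum, ← hcurry,
    ← Measure.map_prod_map _ _ measurable_id (by fun_prop), Measure.map_id]
  rfl

lemma map_affine_laplace_one {b : ℝ} (hb : 0 < b) (x : ℝ) :
    (laplace 1).map (fun z => x + b * z) = (laplace b).map (fun z => x + z) := by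
  rw [← map_mul_laplace_one hb, Measure.map_map (by fun_prop) (by fun_prop)]
  rfl

/-- The noisy bins as a function of their variates. -/
def perturbBins (ε : ℝ) (h : Fin n → ℕ) (u : Fin n → ℝ) (i : Fin n) : ℝ :=
  h i + 1 / groupingBudget ε * u i

/-- The published tree as a function of the grouping and of the variates of the nodes. -/
def perturbTree (ε : ℝ) (α : Fin (height n f) → ℝ) (h : Fin n → ℕ) (P : Grouping n f)
    (z : Tree n f) : Tree n f :=
  assemble P fun k j => ((levelHistogram h k j +
    1 / (α k * levelBudget n f ε) * z k j : ℝ) : EReal)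

lemma measurable_perturbBins (h : Fin n → ℕ) : Measurable (perturbBins ε h) := by
  unfold perturbBins; fun_prop

lemma measurable_perturbTree (h : Fin n → ℕ) (P : Grouping n f) :
    Measurable (perturbTree ε α h P) :=
  (measurable_assemble P).comp (by fun_prop)

lemma smoothing_eq_map (hε : 0 < ε) {sel : (Fin n → ℝ) → Grouping n f} (hsel : Measurable sel)
    (h : Fin n → ℕ) : smoothing ε sel h = (binNoise n).map (sel ∘ perturbBins ε h) := by
  have hb : 0 < 1 / groupingBudget ε := by unfold groupingBudget; positivity
  rw [← Measure.map_map hsel (measurable_perturbBins h), smoothing, binNoise]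
  congr 1
  simp only [← map_affine_laplace_one hb]
  have (i : Fin n) : IsProbabilityMeasure
      ((laplace 1).map fun z => (h i : ℝ) + 1 / groupingBudget ε * z) :=
    Measure.isProbabilityMeasure_map (by fun_prop)
  exact (Measure.pi_map_pi (f := fun i z => (h i : ℝ) + 1 / groupingBudget ε * z)
    fun i => by fun_prop).symm

open Classical in
/-- The output of a Hierarchy Level module at a node, as a function of the variate of the node. -/
def perturbNode (ε : ℝ) (α : Fin (height n f) → ℝ) (h : Fin n → ℕ) (P : Grouping n f)
    (k : Fin (height n f)) (j : Fin (levelSize n f k)) (z : ℝ) : EReal :=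
  if scalars P k j = 0 then ⊤
  else ((levelHistogram h k j + 1 / (α k * levelBudget n f ε) * z : ℝ) : EReal)

lemma measurable_perturbNode (h : Fin n → ℕ) (P : Grouping n f) (k : Fin (height n f))
    (j : Fin (levelSize n f k)) : Measurable (perturbNode ε α h P k j) := by
  unfold perturbNode; split_ifs <;> fun_prop

lemma levelOutput_eq_map (hε : 0 < ε) (hα : ∀ k, 0 < α k) (h : Fin n → ℕ) (P : Grouping n f)
    (k : Fin (height n f)) : levelOutput ε α P k h =
      (Measure.pi fun _ => laplace 1).map fun z j => perturbNode ε α h P k j (z j) := by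
  have hpos := mul_pos (hα k) (levelBudget_pos (n := n) (f := f) hε)
  have : ∀ j, IsProbabilityMeasure ((laplace 1).map (perturbNode ε α h P k j)) := fun j =>
    Measure.isProbabilityMeasure_map (measurable_perturbNode h P k j).aemeasurable
  rw [Measure.pi_map_pi fun j => (measurable_perturbNode h P k j).aemeasurable, levelOutput,
    hierarchyLevel]
  congr 1
  funext j
  rcases scalars_eq_zero_or_one P k j with hs | hs
  · have : perturbNode ε α h P k j = fun _ => ⊤ := by
      funext z; rw [perturbNode, if_pos hs]
    rw [this, if_pos hs, Measure.map_const, measure_univ, one_smul]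
  · have : perturbNode ε α h P k j = (fun x : ℝ => (x : EReal)) ∘
        fun z => levelHistogram h k j + 1 / (α k * levelBudget n f ε) * z := by
      funext z; rw [perturbNode, if_neg (by rw [hs]; exact one_ne_zero)]; rfl
    rw [this, if_neg (by rw [hs]; exact one_ne_zero),
      ← Measure.map_map (by fun_prop) (by fun_prop), map_affine_laplace_one (one_div_pos.2 hpos),
      Measure.map_map (by fun_prop) (by fun_prop), hs, mul_one]
    rfl

lemma treeGiven_eq_map (hf : 2 ≤ f) (hε : 0 < ε) (hα : ∀ k, 0 < α k) (h : Fin n → ℕ)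
    (P : Grouping n f) : treeGiven ε α h P = (treeNoise n f).map (perturbTree ε α h P) := by
  classical
  have hm (k : Fin (height n f)) : Measurable
      fun (z : Fin (levelSize n f k) → ℝ) j => perturbNode ε α h P k j (z j) :=
    measurable_pi_iff.2 fun j => (measurable_perturbNode h P k j).comp (measurable_pi_apply j)
  have : ∀ k : Fin (height n f), IsProbabilityMeasure ((Measure.pi fun _ => laplace 1).map
      fun (z : Fin (levelSize n f k) → ℝ) j => perturbNode ε α h P k j (z j)) := fun k =>
    Measure.isProbabilityMeasure_map (hm k).aemeasurable
  have hF : Measurable fun (z : Tree n f) k j => perturbNode ε α h P k j (z k j) :=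
    measurable_pi_iff.2 fun k => (hm k).comp (measurable_pi_apply k)
  have hcongr : perturbTree ε α h P = assemble P ∘
      fun (z : Tree n f) k j => perturbNode ε α h P k j (z k j) := by
    funext z
    refine assemble_congr hf fun v hv => ?_
    have : scalars P v.1 v.2 ≠ 0 := by
      rw [scalars, if_neg (show ¬ IsPruned P ⟨v.1, v.2⟩ from hv)]; exact one_ne_zero
    simp only [perturbNode, if_neg this]
  rw [treeGiven, hcongr, ← Measure.map_map (measurable_assemble P) hF, treeNoise]
  simp only [levelOutput_eq_map hε hα]
  congr 1
  exact (Measure.pi_map_pi fun k => (hm k).aemeasurable).symm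

lemma outTree_eq (hf : 2 ≤ f) (debias : Bool) (h : Fin n → ℕ) (ω : ℕ → ℝ) :
    outTree hf ε debias α h ω = perturbTree ε α h
      (optSel hf ε debias (perturbBins ε h (splitVariates n f ω).1)) (splitVariates n f ω).2 := by
  have : (fun (k : Fin (height n f)) (j : Fin (levelSize n f k)) =>
      (noisyNode ε α h ω k j : EReal)) = fun k j => ((levelHistogram h k j +
        1 / (α k * levelBudget n f ε) * (splitVariates n f ω).2 k j : ℝ) : EReal) := by
    funext k j
    have hk : αArray α k = α k := by simp [αArray]
    rw [noisyNode, hk]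
    rfl
  rw [outTree, this]
  rfl

/-- The tree as a function of the grouping and the variates is jointly measurable, as there are
finitely many groupings. -/
lemma measurable_outTree_aux (hf : 2 ≤ f) (debias : Bool) (h : Fin n → ℕ) :
    Measurable fun uz : (Fin n → ℝ) × Tree n f =>
      perturbTree ε α h (optSel hf ε debias (perturbBins ε h uz.1)) uz.2 := by
  have : Countable (Grouping n f) := by unfold Grouping; infer_instance
  have hj : Measurable fun Pz : Grouping n f × Tree n f => perturbTree ε α h Pz.1 Pz.2 :=
    measurable_from_prod_countable_right fun P => measurable_perturbTree h P
  exact hj.comp ((((measurable_optSel hf ε debias).comp (measurable_perturbBins h)).comp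
    measurable_fst).prodMk measurable_snd)

lemma measurable_outTree (hf : 2 ≤ f) (debias : Bool) (h : Fin n → ℕ) :
    Measurable (outTree hf ε debias α h) := by
  have : outTree hf ε debias α h = (fun uz : (Fin n → ℝ) × Tree n f =>
      perturbTree ε α h (optSel hf ε debias (perturbBins ε h uz.1)) uz.2) ∘ splitVariates n f :=
    funext fun ω => outTree_eq hf debias h ω
  rw [this]
  exact (measurable_outTree_aux hf debias h).comp measurable_splitVariates

lemma map_outTree (hf : 2 ≤ f) (hε : 0 < ε) (hα : ∀ k, 0 < α k) (debias : Bool) (h : Fin n → ℕ) :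
    (Measure.infinitePi fun _ : ℕ => laplace 1).map (outTree hf ε debias α h) =
      scheme ε α (smoothing ε (optSel hf ε debias)) h := by
  have hm := measurable_outTree_aux (ε := ε) (α := α) hf debias h
  have : outTree hf ε debias α h = (fun uz : (Fin n → ℝ) × Tree n f =>
      perturbTree ε α h (optSel hf ε debias (perturbBins ε h uz.1)) uz.2) ∘ splitVariates n f :=
    funext fun ω => outTree_eq hf debias h ω
  rw [this, ← Measure.map_map hm measurable_splitVariates, map_splitVariates]
  ext S hS
  have hsel := measurable_optSel (n := n) hf ε debias
  rw [Measure.map_apply hm hS, Measure.prod_apply (hm hS), scheme,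
    smoothing_eq_map hε hsel, Measure.bind_apply hS measurable_from_top.aemeasurable,
    lintegral_map measurable_from_top (hsel.comp (measurable_perturbBins h))]
  refine lintegral_congr fun u => ?_
  rw [treeGiven_eq_map hf hε hα, Measure.map_apply (measurable_perturbTree h _) hS]
  rfl

end Law

end SubtreeSmoothing
end

open SubtreeSmoothing
theorem mainTheorem4 :
    -- privacy
    (∀ (n f : ℕ) (ε : ℝ) (α : Fin (height n f) → ℝ),
      0 < n → 2 ≤ f → 0 < ε → (∀ k, 0 < α k) → ∑ k, α k = (height n f : ℝ) →
      ∀ (R : Type*) (F : Multiset R → Fin n → ℕ), IsHistogramAlgorithm F →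
        -- each Hierarchy Level module
        (∀ (P : Grouping n f) (k : Fin (height n f)),
          IsDP F (α k * (3 * ε) / (4 * (height n f : ℝ))) (levelOutput ε α P k)) ∧
        -- the scheme, for any Smoothing module that spends the budget `ε / 4`
        (∀ Q : (Fin n → ℕ) → Measure (Grouping n f), (∀ h, IsProbabilityMeasure (Q h)) →
          IsDP F (ε / 4) Q →
          (∀ h, IsProbabilityMeasure (scheme ε α Q h)) ∧ IsDP F ε (scheme ε α Q)) ∧
        -- the Smoothing module and the scheme, for the squared error metric
        (∀ (debias : Bool) (sel : (Fin n → ℝ) → Grouping n f), IsOptimalSelection ε debias sel →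
          (∀ h, IsProbabilityMeasure (smoothing ε sel h)) ∧
          IsDP F (ε / 4) (smoothing ε sel) ∧
          (∀ h, IsProbabilityMeasure (scheme ε α (smoothing ε sel) h)) ∧
          IsDP F ε (scheme ε α (smoothing ε sel)))) ∧
    -- running time for the squared error metric
    (∀ debias : Bool, ∃ (p : Prog) (C : ℕ),
      ∀ (n f : ℕ) (ε : ℝ) (α : Fin (height n f) → ℝ),
        0 < n → 2 ≤ f → 0 < ε → (∀ k, 0 < α k) → ∑ k, α k = (height n f : ℝ) →
        ∃ sel : (Fin n → ℝ) → Grouping n f, IsOptimalSelection ε debias sel ∧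
          ∀ h : Fin n → ℕ, SamplesWithin p ε α h (C * n) (scheme ε α (smoothing ε sel) h)) := by
  constructor
  · intro n f ε α _ _ hε hα hsum R F hF
    refine ⟨fun P k => ?_, fun Q hQ hDP => ⟨fun h => isProbabilityMeasure_scheme hε hα h (hQ h),
      isDP_scheme hε hα hsum hF hDP⟩, fun debias sel hsel => ?_⟩
    · have hc : α k * (3 * ε) / (4 * (height n f : ℝ)) = α k * levelBudget n f ε := by
        rw [levelBudget]
        field_simp
      rw [hc]
      exact isDP_of_isClose hF fun h h' hh => levelOutput_le hε hα P k hh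
    · have hprob := isProbabilityMeasure_smoothing hε hsel.1
      have hdp : IsDP F (ε / 4) (smoothing ε sel) :=
        isDP_of_isClose hF fun h h' hh => smoothing_le hε hsel.1 hh
      exact ⟨hprob, hdp, fun h => isProbabilityMeasure_scheme hε hα h (hprob h),
        isDP_scheme hε hα hsum hF hdp⟩
  · intro debias
    refine ⟨treeProg debias, stepsPerBin debias, fun n f ε α hn hf hε hα _ =>
      ⟨optSel hf ε debias, isOptimalSelection_optSel hn hf ε debias, fun h =>
        ⟨outTree hf ε debias α h, fun ω => ?_, measurable_outTree hf debias h,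
          map_outTree hf hε hα debias h⟩⟩⟩
    exact ends_treeProg hn hf ε debias α h ω
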